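/- **Theorem (Equations of gravitational electrodynamics with external force field).** Units are such that the speed of light is $c=1$. Consider $n$ bodies with rest masses $m_{0j}>0$ and charges $q_j\in\mathbb R$, and trajectories $y=(y_1,\dots,y_n)$, $y_j=(r_j,v_j)$ with $r_j(t),v_j(t)\in\mathbb R^3$ and $v_j=\dot r_j$; the norm of a state is $|y|=\max_j\{|r_j|,|v_j|\}$, and $\mathrm{sep}(y)(t)=\min_{j\ne k}|r_j(t)-r_k(t)|$ (equal to $+\infty$ if $n\le 1$). *Trajectories.* Let $\mathcal T((-\infty,d])$ be the set of trajectories on $(-\infty,d]$ with $v_j=\dot r_j$, with speeds bounded by some constant $<1$, and with Lipschitz continuous velocities $v_j$; let $\mathcal T=\bigcup_d\mathcal T((-\infty,d])$. An initial trajectory $x$ on $(-\infty,s]$ is *admissible* if the $r_j$ are of class $C^3$, the speeds are bounded by some constant $<1$ (i.e. the kinetic energies are bounded) and the accelerations are bounded. *Regular operators.* For $x\in\mathcal T((-\infty,s])$, $0\le\kappa<1$, $A\ge0$, $s\le e$, the initial domain $D(x,\kappa,A,[s,e])$ is the set of trajectories $y=(r,v)$ on $(-\infty,e]$ with $v=\dot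 r$ that extend $x$ and satisfy $|r_j(t)-r_j(t')|\le\kappa|t-t'|$ and $|v_j(t)-v_j(t')|\le A|t-t'|$ for all $j$ and all $t,t'\le e$. It is *regular* if $\mathrm{sep}(x)(s)>0$ and $0<e-s<\mathrm{sep}(x)(s)/(3(1+\kappa))$. An operator $P$ mapping each $y\in\mathcal T((-\infty,d])$ to a continuous function $P(y):(-\infty,d]\to\mathbb R^{3n}$ is *nonanticipating* if $y=z$ on $(-\infty,d]$ implies $P(y)=P(z)$ on $(-\infty,d]$. It is *regular* if moreover for every regular initial domain $D(x,\kappa,A,[s,e])$ there is a constant $M$ with $$\sup_{t\in[s,d]}|P(y)(t)-P(z)(t)|\le M\sup_{t\in[s,d]}|y(t)-z(t)|\quad\text{for all } d\in[s,e],\ y,z\in D(x,\kappa,A,[s,d]).$$ *Forces.* For the $k$-th path $r_k$ and a point $(r_1,t)$ off the path let $\tau\le t$ be the retarded time, $\tau=t-|r_1-r_k(\tau)|$, and put $T=t-\tau$, $u=1/T$, $e=u\,(r_1-r_k(\tau))$. The Newton–Feynman field of the path is $$E(r_1,t)=u^2e+u^{-1}\frac{\partial}{\partial t}(u^2e)+\frac{\partial^2}{\partial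 t^2}e ,$$ where the derivatives are taken at fixed $r_1$. Let $E_{jk}(t)$ and $e_{jk}(t)$ be the values of $E$ and $e$, formed with the path $r_k$, at the point $(r_j(t),t)$. The Lorentz–Newton force is $$F_j=\sum_{k\ne j}H_{jk}(E_{jk}),\qquad H_{jk}(h)=q_j\{h+v_j\times(e_{jk}\times h)\}-m_{0k}h .$$ Let the external forces $F_0=(F_{j0})_{j=1}^n$ form a regular nonanticipating operator with values in $\mathbb R^{3n}$, and let $p_j=m_{0j}(1-|v_j|^2)^{-1/2}v_j$ be the relativistic momenta. *Solutions.* Let $I$ be a nondegenerate interval with $s=\min I$; on the right it may be open or closed, bounded or unbounded. A *solution on $I$ extending $x$* is a trajectory $y$ on $(-\infty,s]\cup I$ that equals $x$ on $(-\infty,s]$, whose restriction to $(-\infty,t]$ lies in $\mathcal T((-\infty,t])$ for all $t\in I$, for which $\mathrm{sep}(y)(t)>0$ for all $t\in I$ and all the fields $E_{jk}(t)$, $t\in I$, $j\neq k$, exist, and which satisfies the Newton–Einstein system $$\dot p_j(t)=F_j(t)+F_{j0}(t)\quad\text{for all }t\in I,\ j=1,\dots,n$$ (with one-sided derivatives at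 end points of $I$). *Claim.* For every admissible initial trajectory $x$ on $(-\infty,s]$ with $\mathrm{sep}(x)(s)>0$ there is a unique maximal solution with positive separation: there are such an interval $I$ and a solution $y$ on $I$ extending $x$ such that every solution $y'$ extending $x$, on any such interval $I'$, satisfies $I'\subseteq I$ and $y'=y$ on $I'$. -/

import Mathlib

open Set Filter Topology
open scoped ENNReal

noncomputable section

/-- Position and velocity space `R³` with the Euclidean norm. The speed of light is `c = 1`. -/
abbrev E3 : Type := EuclideanSpace ℝ (Fin 3)

/-- States `(r_j, v_j)`, `j = 1, …, n`, of a system of `n` bodies. The norm of this type is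
`max {|r_j|, |v_j|}`. -/
abbrev BodyState (n : ℕ) : Type := Fin n → E3 × E3

/-- A trajectory of the system. A trajectory on `(-∞, d]` is represented by a function on `ℝ` of
which only the values on `Iic d` are relevant. -/
abbrev Traj (n : ℕ) : Type := ℝ → BodyState n

namespace Traj

variable {n : ℕ}

/-- The position of the `j`-th body. -/
def pos (y : Traj n) (j : Fin n) (t : ℝ) : E3 := (y t j).1

/-- The velocity of the `j`-th body. -/
def vel (y : Traj n) (j : Fin n) (t : ℝ) : E3 := (y t j).2

/-- On `(-∞, d]` the second components are the velocities of the first components. -/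
def IsKinematic (y : Traj n) (d : ℝ) : Prop :=
  ∀ j, ∀ t ≤ d, HasDerivWithinAt (y.pos j) (y.vel j t) (Iic d) t

/-- The space `𝒯((-∞, d])` on which nonanticipating operators act: the speeds are bounded by
some `κ < 1` and the velocities satisfy a Lipschitz condition. It contains all initial domains
that end at `d`. -/
def MemSpace (y : Traj n) (d : ℝ) : Prop :=
  y.IsKinematic d ∧
  (∃ κ < (1 : ℝ), ∀ j, ∀ t ≤ d, ‖y.vel j t‖ ≤ κ) ∧
  ∃ A : ℝ, ∀ j, ∀ t ≤ d, ∀ t' ≤ d, ‖y.vel j t - y.vel j t'‖ ≤ A * |t - t'|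

/-- Admissible trajectories on `(-∞, s]`: three continuous derivatives, speed (equivalently,
kinetic energy) bounded away from that of light, bounded acceleration. -/
def IsAdmissible (x : Traj n) (s : ℝ) : Prop :=
  x.IsKinematic s ∧
  (∀ j, ContDiffOn ℝ 3 (x.pos j) (Iic s)) ∧
  (∃ κ < (1 : ℝ), ∀ j, ∀ t ≤ s, ‖x.vel j t‖ ≤ κ) ∧
  ∃ A : ℝ, ∀ j, ∀ t ≤ s, ‖iteratedDerivWithin 2 (x.pos j) (Iic s) t‖ ≤ A

/-- The separation `min {|r_j(t) - r_k(t)| : j ≠ k}`; it is `∞` if there are fewer than two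
bodies. -/
def sep (y : Traj n) (t : ℝ) : ℝ≥0∞ :=
  ⨅ (j : Fin n) (k : Fin n) (_ : j ≠ k), edist (y.pos j t) (y.pos k t)

/-- The initial domain `D(x, κ, A, [s, e])`. -/
def initialDomain (x : Traj n) (κ A s e : ℝ) : Set (Traj n) :=
  {y | EqOn y x (Iic s) ∧ y.IsKinematic e ∧
    (∀ j, ∀ t ≤ e, ∀ t' ≤ e, ‖y.pos j t - y.pos j t'‖ ≤ κ * |t - t'|) ∧
    (∀ j, ∀ t ≤ e, ∀ t' ≤ e, ‖y.vel j t - y.vel j t'‖ ≤ A * |t - t'|)}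

/-- The parameters `x, κ, A, [s, e]` generate a regular initial domain: the separation
`sep(x)(s)` is positive and `0 < e - s < sep(x)(s) / (3 (1 + κ))`. -/
def IsRegularDomain (x : Traj n) (κ A s e : ℝ) : Prop :=
  x.MemSpace s ∧ 0 ≤ κ ∧ κ < 1 ∧ 0 ≤ A ∧ s < e ∧
    ENNReal.ofReal (3 * (1 + κ) * (e - s)) < x.sep s

end Traj

/-- The norm of `C([s, d], Y)`. -/
def supNormOn {Y : Type*} [Norm Y] (s d : ℝ) (f : ℝ → Y) : ℝ := ⨆ t : Icc s d, ‖f t‖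

/-- Nonanticipating operators with values in `Y`: trajectories in `𝒯((-∞, d])` are mapped to
continuous functions on `(-∞, d]`, and the image up to any time `d` depends only on the
trajectory up to time `d`. -/
def IsNonanticipating {n : ℕ} {Y : Type*} [NormedAddCommGroup Y] (P : Traj n → ℝ → Y) : Prop :=
  (∀ (d : ℝ) (y : Traj n), y.MemSpace d → ContinuousOn (P y) (Iic d)) ∧
  ∀ (d : ℝ) (y z : Traj n), y.MemSpace d → z.MemSpace d →
    EqOn y z (Iic d) → EqOn (P y) (P z) (Iic d)

/-- The operator `P` is uniformly Lipschitzian on the initial domain `D(x, κ, A, [s, e])`. -/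
def IsUniformlyLipschitzian {n : ℕ} {Y : Type*} [NormedAddCommGroup Y] (P : Traj n → ℝ → Y)
    (x : Traj n) (κ A s e : ℝ) : Prop :=
  ∃ M : ℝ, ∀ d ∈ Icc s e, ∀ y ∈ x.initialDomain κ A s d, ∀ z ∈ x.initialDomain κ A s d,
    supNormOn s d (fun t => P y t - P z t) ≤ M * supNormOn s d (fun t => y t - z t)

/-- Regular nonanticipating operators: nonanticipating, and uniformly Lipschitzian on every
regular initial domain. -/
def IsRegularNonanticipating {n : ℕ} {Y : Type*} [NormedAddCommGroup Y]
    (P : Traj n → ℝ → Y) : Prop :=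
  IsNonanticipating P ∧ ∀ (x : Traj n) (κ A s e : ℝ), x.IsRegularDomain κ A s e →
    IsUniformlyLipschitzian P x κ A s e

/-! ### The fields generated by the path of a single body

In this section `r : ℝ → E3` is a path known on `(-∞, d]`. -/

namespace Field

variable (r : ℝ → E3) (d : ℝ) (r₁ : E3) (t : ℝ)

/-- The retarded time `τ(r₁, t)`: the solution `τ` of `τ = t - |r₁ - r(τ)|`. It is unique if
the speed on `(-∞, d]` is bounded by some `κ < 1`, and if moreover `r₁ ≠ r(d)` it exists for all
`t` in a neighbourhood of `(-∞, d]`. -/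
def tau : ℝ := Classical.epsilon fun τ : ℝ => τ ≤ d ∧ τ = t - ‖r₁ - r τ‖

/-- The delay `T = t - τ`. -/
def delay : ℝ := t - tau r d r₁ t

/-- `u = 1 / T`. -/
def u : ℝ := 1 / delay r d r₁ t

/-- The unit vector field `e = u (r₁ - r(τ))`. -/
def e : E3 := u r d r₁ t • (r₁ - r (tau r d r₁ t))

/-- All partial derivatives with respect to time that occur in the Newton-Feynman formula exist
at the point `(r₁, t)`. -/
def Exists : Prop :=
  DifferentiableAt ℝ (fun t' => u r d r₁ t' ^ 2 • e r d r₁ t') t ∧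
  (∀ᶠ t' in 𝓝 t, DifferentiableAt ℝ (fun t'' => e r d r₁ t'') t') ∧
  DifferentiableAt ℝ (deriv fun t' => e r d r₁ t') t

/-- The Newton-Feynman field `E = u² e + u⁻¹ D(u² e) + D² e` with `D = ∂/∂t`. -/
def newtonFeynman : E3 :=
  u r d r₁ t ^ 2 • e r d r₁ t
    + (u r d r₁ t)⁻¹ • deriv (fun t' => u r d r₁ t' ^ 2 • e r d r₁ t') t
    + deriv (deriv fun t' => e r d r₁ t') t

end Field

/-- The cross product of `R³`. -/
def cross (a b : E3) : E3 := WithLp.toLp 2 (crossProduct (WithLp.ofLp a) (WithLp.ofLp b))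

namespace Traj

variable {n : ℕ}

/-- The unit vector `e_jk(t)`, from the retarded position of the `k`-th body to the position of
the `j`-th body at time `t`. -/
def unitVec (y : Traj n) (j k : Fin n) (t : ℝ) : E3 := Field.e (y.pos k) t (y.pos j t) t

/-- The Newton-Feynman field `E_jk(t)` acting onto the `j`-th body from the trajectory of the
`k`-th body. It depends only on the trajectory up to time `t`. -/
def fieldOn (y : Traj n) (j k : Fin n) (t : ℝ) : E3 :=
  Field.newtonFeynman (y.pos k) t (y.pos j t) t

/-- The derivatives that define `E_jk(t)` exist. -/
def FieldExists (y : Traj n) (j k : Fin n) (t : ℝ) : Prop :=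
  Field.Exists (y.pos k) t (y.pos j t) t

/-- `H_jk(h) = q_j {h + v_j × (e_jk × h)} - m_{0k} h` at time `t`. -/
def opH (m₀ q : Fin n → ℝ) (y : Traj n) (j k : Fin n) (t : ℝ) (h : E3) : E3 :=
  q j • (h + cross (y.vel j t) (cross (y.unitVec j k t) h)) - m₀ k • h

/-- The Lorentz-Newton force `F_j = ∑_{k ≠ j} H_jk(E_jk)`. -/
def lorentzNewton (m₀ q : Fin n → ℝ) (y : Traj n) (j : Fin n) (t : ℝ) : E3 :=
  ∑ k ∈ Finset.univ.filter (fun k => k ≠ j), y.opH m₀ q j k t (y.fieldOn j k t)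

/-- The relativistic momentum `p_j = m_{0j} (1 - |v_j|²)^{-1/2} v_j`. -/
def momentum (m₀ : Fin n → ℝ) (y : Traj n) (j : Fin n) (t : ℝ) : E3 :=
  (m₀ j * (√(1 - ‖y.vel j t‖ ^ 2))⁻¹) • y.vel j t

end Traj

/-- Nondegenerate intervals starting at `s` and containing `s`; on the right the interval may be
open or closed, bounded or unbounded. -/
def IsIntervalFrom (s : ℝ) (I : Set ℝ) : Prop :=
  I.OrdConnected ∧ s ∈ I ∧ (∀ t ∈ I, s ≤ t) ∧ ∃ t ∈ I, s < t

/-- The trajectory `y` extends `x` from `(-∞, s]` onto the interval `I` starting at `s`, has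
positive separation on `I`, and solves the Newton-Einstein system `p_j' = F_j + F_{j0}` on `I`
(with a one-sided derivative at an end point of `I`). -/
structure IsSolution {n : ℕ} (m₀ q : Fin n → ℝ) (F₀ : Traj n → ℝ → Fin n → E3)
    (s : ℝ) (x : Traj n) (I : Set ℝ) (y : Traj n) : Prop where
  extends_initial : EqOn y x (Iic s)
  memSpace : ∀ t ∈ I, y.MemSpace t
  sep_pos : ∀ t ∈ I, 0 < y.sep t
  fieldExists : ∀ t ∈ I, ∀ j k, j ≠ k → y.FieldExists j k t
  equation : ∀ t ∈ I, ∀ j,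
    HasDerivWithinAt (y.momentum m₀ j) (y.lorentzNewton m₀ q j t + F₀ y t j) I t

end

/-! Positive separation makes the problem local. A signal received by body `j` from body `k` shortly
after a time `a` was emitted strictly before `a`, so over a short time the fields are determined by
the past alone, and the bodies are coupled only through the external force.

Existence: off the path of a `C³` body the retarded time is a `C³` function of the point by the
implicit function theorem. The field costs two time derivatives, so it is `C¹`. Just after `s` the
internal force is therefore a locally Lipschitz function of position, velocity and time. Integrating
the force to momenta and passing back to velocities is a contraction on a short interval
(`Traj.exists_local_solution`, `exists_isSolution`).

Uniqueness is harder: the step from `a` onwards must be possible at every later time `a`, when the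
past is only known to have Lipschitz velocities. The field contains retarded accelerations and need
not depend on position in a Lipschitz way. With `N` the vector from the retarded position and `V`
the retarded velocity, it is a smooth function of `(N, V)` plus the partial time derivative of
`dirRate (N, V)`. Along a moving body this partial derivative is, up to the Doppler factor and a
smooth term, the total derivative of `G = dirRate (N, V)` (`IsPath.hasDerivWithinAt_dirRate`). The
force is thus a smooth term plus `B G'`, with `B` a smooth operator. For two solutions, integration
by parts moves the dangerous term `B (G₁' - G₂')` into the derivative of `B (G₁ - G₂)`, which is
bounded by the distance of the positions (`IsPath.exists_compensator`). Once this function is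
subtracted from the difference of the momenta, a Gronwall-type estimate shows that the solutions
agree for some further time (`SolvesOn.exists_eqOn`).

Continuous induction turns this into uniqueness on common intervals (`IsSolution.eqOn_Iic`), and the
union of all solutions is the maximal one. -/

noncomputable section

/-! ### Paths with subluminal speed and their retarded times -/

/-- `ρ` is a path on `(-∞, a]` with velocity `w`, speed at most `κ < 1`, and `w` is Lipschitz. -/
structure IsPath (ρ w : ℝ → E3) (a κ A : ℝ) : Prop where
  nonneg : 0 ≤ κ
  lt_one : κ < 1
  pos_lip : ∀ t ≤ a, ∀ t' ≤ a, ‖ρ t - ρ t'‖ ≤ κ * |t - t'|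
  hasDeriv : ∀ t ≤ a, HasDerivWithinAt ρ (w t) (Iic a) t
  vel_lip : ∀ t ≤ a, ∀ t' ≤ a, ‖w t - w t'‖ ≤ A * |t - t'|

namespace IsPath

variable {ρ w : ℝ → E3} {a κ A : ℝ}

theorem mono (h : IsPath ρ w a κ A) {b : ℝ} (hb : b ≤ a) : IsPath ρ w b κ A where
  nonneg := h.nonneg
  lt_one := h.lt_one
  pos_lip t ht t' ht' := h.pos_lip t (ht.trans hb) t' (ht'.trans hb)
  hasDeriv t ht := (h.hasDeriv t (ht.trans hb)).mono (Iic_subset_Iic.2 hb)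
  vel_lip t ht t' ht' := h.vel_lip t (ht.trans hb) t' (ht'.trans hb)

theorem hasDerivAt (h : IsPath ρ w a κ A) {t : ℝ} (ht : t < a) : HasDerivAt ρ (w t) t :=
  (h.hasDeriv t ht.le).hasDerivAt (Iic_mem_nhds ht)

theorem continuousOn (h : IsPath ρ w a κ A) : ContinuousOn ρ (Iic a) :=
  fun t ht => (h.hasDeriv t ht).continuousWithinAt

theorem continuousAt_vel (h : IsPath ρ w a κ A) {t : ℝ} (ht : t < a) : ContinuousAt w t := by
  have hl : Tendsto (fun t' => A * |t' - t|) (𝓝 t) (𝓝 0) := by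
    have : Continuous fun t' => A * |t' - t| := by fun_prop
    simpa using this.tendsto t
  rw [ContinuousAt, tendsto_iff_norm_sub_tendsto_zero]
  refine squeeze_zero' (Eventually.of_forall fun _ => norm_nonneg _) ?_ hl
  filter_upwards [Iic_mem_nhds ht] with t' ht' using h.vel_lip t' ht' t ht.le

theorem norm_vel_le (h : IsPath ρ w a κ A) {t : ℝ} (ht : t < a) : ‖w t‖ ≤ κ := by
  refine (h.hasDerivAt ht).le_of_lip' h.nonneg ?_
  filter_upwards [Iic_mem_nhds ht] with t' ht'
  simpa [Real.norm_eq_abs] using h.pos_lip t' ht' t ht.le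

theorem contDiffAt_one (h : IsPath ρ w a κ A) {t : ℝ} (ht : t < a) : ContDiffAt ℝ 1 ρ t := by
  have hC : ContDiffOn ℝ 1 ρ (Iio a) := by
    rw [contDiffOn_one_iff_derivWithin isOpen_Iio.uniqueDiffOn]
    refine ⟨fun t' ht' => (h.hasDerivAt ht').differentiableAt.differentiableWithinAt, ?_⟩
    have : ContinuousOn w (Iio a) := fun t' ht' => (h.continuousAt_vel ht').continuousWithinAt
    refine this.congr fun t' ht' => ?_
    exact (h.hasDerivAt ht').hasDerivWithinAt.derivWithin (isOpen_Iio.uniqueDiffOn t' ht')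
  exact hC.contDiffAt (Iio_mem_nhds ht)

/-- Two points on the path and their arrival times. -/
theorem abs_sub_le (h : IsPath ρ w a κ A) {r r' : E3} {t t' σ σ' : ℝ} (hσ : σ ≤ a) (hσ' : σ' ≤ a)
    (e : σ = t - ‖r - ρ σ‖) (e' : σ' = t' - ‖r' - ρ σ'‖) :
    (1 - κ) * |σ - σ'| ≤ |t - t'| + ‖r - r'‖ := by
  have h1 := h.pos_lip σ hσ σ' hσ'
  have h2 : |‖r - ρ σ‖ - ‖r' - ρ σ'‖| ≤ ‖r - r'‖ + ‖ρ σ - ρ σ'‖ := by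
    refine (abs_norm_sub_norm_le _ _).trans ?_
    rw [show r - ρ σ - (r' - ρ σ') = (r - r') - (ρ σ - ρ σ') by abel]
    exact norm_sub_le _ _
  have h3 : |σ - σ'| ≤ |t - t'| + |‖r - ρ σ‖ - ‖r' - ρ σ'‖| := by
    have : σ - σ' = (t - t') - (‖r - ρ σ‖ - ‖r' - ρ σ'‖) := by linarith
    rw [this]; exact abs_sub _ _
  linarith

/-- The speed bound `κ < 1` allows only one retarded time, so the choice made by `Classical.epsilon`
is forced. All later identifications of the retarded time go through this. -/
theorem tau_eq (h : IsPath ρ w a κ A) {r : E3} {t σ : ℝ} (hσ : σ ≤ a) (e : σ = t - ‖r - ρ σ‖) :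
    Field.tau ρ a r t = σ := by
  have hs := Classical.epsilon_spec (p := fun τ : ℝ => τ ≤ a ∧ τ = t - ‖r - ρ τ‖) ⟨σ, hσ, e⟩
  have := h.abs_sub_le hs.1 hσ hs.2 e
  simp only [sub_self, abs_zero, norm_zero, add_zero] at this
  have h0 : |Field.tau ρ a r t - σ| ≤ 0 := by
    have := h.lt_one
    by_contra! hc
    have : 0 < (1 - κ) * |Field.tau ρ a r t - σ| := mul_pos (by linarith) hc
    exact absurd ‹_ ≤ (0 : ℝ)› (not_le.2 this)
  simpa [sub_eq_zero] using h0

theorem exists_tau (h : IsPath ρ w a κ A) {r : E3} {t : ℝ} (ht : t ≤ a + ‖r - ρ a‖) :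
    ∃ σ ≤ a, σ = t - ‖r - ρ σ‖ := by
  have hκ : 0 < 1 - κ := by linarith [h.lt_one]
  -- So far back the signal arrives by time `t`: the speed bound gives `b + ‖r - ρ b‖ ≤ (1 - κ) b +
  -- ‖r - ρ a‖ + κ a`, and `b` is chosen to make the right side at most `t`.
  set b := min a ((t - ‖r - ρ a‖ - κ * a) / (1 - κ)) with hb
  have hba : b ≤ a := min_le_left _ _
  have h1 : b + ‖r - ρ b‖ ≤ t := by
    have h2 := h.pos_lip a le_rfl b hba
    rw [abs_of_nonneg (by linarith)] at h2
    have h3 : ‖r - ρ b‖ ≤ ‖r - ρ a‖ + ‖ρ a - ρ b‖ := norm_sub_le_norm_sub_add_norm_sub _ _ _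
    have h4 : b * (1 - κ) ≤ t - ‖r - ρ a‖ - κ * a := by
      rw [← le_div_iff₀ hκ]; exact min_le_right _ _
    linarith
  have hc : ContinuousOn (fun σ => σ + ‖r - ρ σ‖) (Icc b a) :=
    continuousOn_id.add ((continuousOn_const.sub (h.continuousOn.mono Icc_subset_Iic_self)).norm)
  obtain ⟨σ, hσ, e⟩ := intermediate_value_Icc hba hc ⟨h1, ht⟩
  exact ⟨σ, hσ.2, by simp only at e; linarith⟩

theorem tau_spec (h : IsPath ρ w a κ A) {r : E3} {t : ℝ} (ht : t ≤ a + ‖r - ρ a‖) :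
    Field.tau ρ a r t ≤ a ∧ Field.tau ρ a r t = t - ‖r - ρ (Field.tau ρ a r t)‖ := by
  obtain ⟨σ, hσ, e⟩ := h.exists_tau ht
  rw [h.tau_eq hσ e]; exact ⟨hσ, e⟩

theorem tau_lt (h : IsPath ρ w a κ A) {r : E3} {t : ℝ} (ht : t < a + ‖r - ρ a‖) :
    Field.tau ρ a r t < a := by
  obtain ⟨h1, h2⟩ := h.tau_spec ht.le
  refine lt_of_le_of_ne h1 fun h3 => ?_
  rw [h3] at h2; linarith

theorem tau_lip (h : IsPath ρ w a κ A) {r r' : E3} {t t' : ℝ} (ht : t ≤ a + ‖r - ρ a‖)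
    (ht' : t' ≤ a + ‖r' - ρ a‖) :
    |Field.tau ρ a r t - Field.tau ρ a r' t'| ≤ (1 - κ)⁻¹ * (|t - t'| + ‖r - r'‖) := by
  obtain ⟨h1, h2⟩ := h.tau_spec ht
  obtain ⟨h1', h2'⟩ := h.tau_spec ht'
  rw [← div_eq_inv_mul, le_div_iff₀' (by linarith [h.lt_one])]
  exact h.abs_sub_le h1 h1' h2 h2'

/-- The retarded time does not depend on the end of the path. -/
theorem tau_congr (h : IsPath ρ w a κ A) {ρ' w' : ℝ → E3} {d κ' A' : ℝ} (h' : IsPath ρ' w' d κ' A')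
    (hd : a ≤ d) (he : EqOn ρ' ρ (Iic a)) {r : E3} {t : ℝ} (ht : t ≤ a + ‖r - ρ a‖) :
    Field.tau ρ' d r t = Field.tau ρ a r t := by
  obtain ⟨h1, h2⟩ := h.tau_spec ht
  refine h'.tau_eq (h1.trans hd) ?_
  rwa [he h1]

theorem eventually_mem (r : E3) (t : ℝ) (ht : t < a + ‖r - ρ a‖) :
    ∀ᶠ z : E3 × ℝ in 𝓝 (r, t), z.2 < a + ‖z.1 - ρ a‖ := by
  have hc : Continuous fun z : E3 × ℝ => a + ‖z.1 - ρ a‖ - z.2 := by fun_prop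
  filter_upwards [hc.continuousAt.eventually (lt_mem_nhds (show 0 < a + ‖r - ρ a‖ - t by linarith))]
    with z hz
  linarith

theorem eventually_mem' (r : E3) (t : ℝ) (ht : t < a + ‖r - ρ a‖) :
    ∀ᶠ t' in 𝓝 t, t' < a + ‖r - ρ a‖ := Iio_mem_nhds ht

section congr

variable (h : IsPath ρ w a κ A) {ρ' w' : ℝ → E3} {d κ' A' : ℝ} (h' : IsPath ρ' w' d κ' A')
  (hd : a ≤ d) (he : EqOn ρ' ρ (Iic a)) {r : E3} {t : ℝ}

include h h' hd he

theorem u_congr (ht : t ≤ a + ‖r - ρ a‖) : Field.u ρ' d r t = Field.u ρ a r t := by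
  simp only [Field.u, Field.delay, h.tau_congr h' hd he ht]

theorem e_congr (ht : t ≤ a + ‖r - ρ a‖) : Field.e ρ' d r t = Field.e ρ a r t := by
  simp only [Field.e, h.u_congr h' hd he ht, h.tau_congr h' hd he ht, he (h.tau_spec ht).1]

end congr
end IsPath

/-! ### The field ingredients as smooth functions of the retarded state -/

/-- The unit vector in the direction of a nonzero vector. -/
def unitDir (N : E3) : E3 := ‖N‖⁻¹ • N

/-- The Coulomb field of a unit charge at rest. -/
def coulomb (N : E3) : E3 := (‖N‖⁻¹) ^ 2 • unitDir N

/-- The time derivative of the retarded time at a fixed point, in terms of the vector `N` from the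
retarded position and the retarded velocity `V`. -/
def tauRate (p : E3 × E3) : ℝ := ‖p.1‖ / (‖p.1‖ - inner ℝ p.1 p.2)

/-- The time derivative of the unit vector field at a fixed point. -/
def dirRate (p : E3 × E3) : E3 := fderiv ℝ unitDir p.1 (-(tauRate p • p.2))

/-- The time derivative of the retarded Coulomb field at a fixed point. -/
def coulombRate (p : E3 × E3) : E3 := fderiv ℝ coulomb p.1 (-(tauRate p • p.2))

/-- The part of the Newton-Feynman field without second derivatives of the path. -/
def nearField (p : E3 × E3) : E3 := coulomb p.1 + ‖p.1‖ • coulombRate p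

theorem contDiffAt_unitDir {n : WithTop ℕ∞} {N : E3} (hN : N ≠ 0) : ContDiffAt ℝ n unitDir N :=
  ((contDiffAt_norm ℝ hN).inv (norm_ne_zero_iff.2 hN)).smul contDiffAt_id

theorem contDiffAt_coulomb {n : WithTop ℕ∞} {N : E3} (hN : N ≠ 0) : ContDiffAt ℝ n coulomb N :=
  (((contDiffAt_norm ℝ hN).inv (norm_ne_zero_iff.2 hN)).pow 2).smul (contDiffAt_unitDir hN)

theorem norm_sub_inner_pos {N V : E3} (hN : N ≠ 0) (hV : ‖V‖ < 1) : 0 < ‖N‖ - inner ℝ N V := by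
  have h1 := real_inner_le_norm N V
  have h2 : ‖N‖ * ‖V‖ < ‖N‖ * 1 := mul_lt_mul_of_pos_left hV (norm_pos_iff.2 hN)
  linarith

section smooth

variable {n : WithTop ℕ∞} {p : E3 × E3} (hN : p.1 ≠ 0) (hV : ‖p.2‖ < 1)
include hN hV

theorem contDiffAt_tauRate : ContDiffAt ℝ n tauRate p := by
  have h1 : ContDiffAt ℝ n (fun p : E3 × E3 => ‖p.1‖) p := contDiffAt_fst.norm ℝ hN
  exact h1.div (h1.sub (contDiffAt_fst.inner ℝ contDiffAt_snd)) (norm_sub_inner_pos hN hV).ne'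

theorem contDiffAt_dirRate : ContDiffAt ℝ 2 dirRate p := by
  have h1 : ContDiffAt ℝ 2 (fun p : E3 × E3 => fderiv ℝ unitDir p.1) p :=
    ((contDiffAt_unitDir (n := 3) hN).fderiv_right (by norm_num)).comp p contDiffAt_fst
  exact h1.clm_apply ((contDiffAt_tauRate hN hV).smul contDiffAt_snd).neg

theorem contDiffAt_coulombRate : ContDiffAt ℝ 2 coulombRate p := by
  have h1 : ContDiffAt ℝ 2 (fun p : E3 × E3 => fderiv ℝ coulomb p.1) p :=
    ((contDiffAt_coulomb (n := 3) hN).fderiv_right (by norm_num)).comp p contDiffAt_fst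
  exact h1.clm_apply ((contDiffAt_tauRate hN hV).smul contDiffAt_snd).neg

theorem contDiffAt_nearField : ContDiffAt ℝ 2 nearField p :=
  ((contDiffAt_coulomb hN).comp p contDiffAt_fst).add
    ((contDiffAt_fst.norm ℝ hN).smul (contDiffAt_coulombRate hN hV))

end smooth

theorem hasDerivWithinAt_norm_of_ne {f : ℝ → E3} {f' : E3} {S : Set ℝ} {t : ℝ}
    (hf : HasDerivWithinAt f f' S t) (h0 : f t ≠ 0) :
    HasDerivWithinAt (fun t => ‖f t‖) (inner ℝ (f t) f' / ‖f t‖) S t := by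
  have h1 := hf.norm_sq.sqrt (by positivity)
  simp only [Real.sqrt_sq (norm_nonneg _)] at h1
  convert h1 using 1
  field_simp

/-! ### Derivatives of the retarded time and of the field off the path -/

namespace IsPath

variable {ρ w : ℝ → E3} {a κ A : ℝ}

/-- The point `(r, t)` is off the path and in the domain of the retarded time. -/
def OffPath (ρ : ℝ → E3) (a : ℝ) (r : E3) (t : ℝ) : Prop :=
  t < a + ‖r - ρ a‖ ∧ Field.tau ρ a r t < t

/-- The vector from the retarded position. -/
def sepVec (ρ : ℝ → E3) (a : ℝ) (r : E3) (t : ℝ) : E3 := r - ρ (Field.tau ρ a r t)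

/-- The retarded velocity. -/
def retVel (ρ w : ℝ → E3) (a : ℝ) (r : E3) (t : ℝ) : E3 := w (Field.tau ρ a r t)

theorem offPath_of_le (h : IsPath ρ w a κ A) {r : E3} {t : ℝ} (hat : a ≤ t)
    (ht : t < a + ‖r - ρ a‖) : OffPath ρ a r t := ⟨ht, (h.tau_lt ht).trans_le hat⟩

section

variable (h : IsPath ρ w a κ A) {r : E3} {t : ℝ} (ht : OffPath ρ a r t)
include h ht

theorem norm_sepVec : ‖sepVec ρ a r t‖ = t - Field.tau ρ a r t := by
  have := (h.tau_spec ht.1.le).2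
  rw [sepVec]; linarith

theorem sepVec_ne : sepVec ρ a r t ≠ 0 := by
  rw [← norm_pos_iff, h.norm_sepVec ht]; linarith [ht.2]

theorem norm_retVel_lt : ‖retVel ρ w a r t‖ < 1 :=
  (h.norm_vel_le (h.tau_lt ht.1)).trans_lt h.lt_one

theorem rate_pos : 0 < ‖sepVec ρ a r t‖ - inner ℝ (sepVec ρ a r t) (retVel ρ w a r t) :=
  norm_sub_inner_pos (h.sepVec_ne ht) (h.norm_retVel_lt ht)

theorem u_eq : Field.u ρ a r t = ‖sepVec ρ a r t‖⁻¹ := by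
  rw [h.norm_sepVec ht, Field.u, Field.delay, one_div]

theorem e_eq : Field.e ρ a r t = unitDir (sepVec ρ a r t) := by
  rw [Field.e, h.u_eq ht]; rfl

/-- Implicit function theorem for `σ + ‖r - ρ σ‖ - t = 0`. The `σ`-derivative `1 - ⟪N, V⟫ / ‖N‖` is
positive because the speed is less than one, so the retarded time is as smooth as the path is at the
time of emission. -/
theorem contDiffAt_tau {n : WithTop ℕ∞} (hn : n ≠ 0) (hρ : ContDiffAt ℝ n ρ (Field.tau ρ a r t)) :
    ContDiffAt ℝ n (fun z : E3 × ℝ => Field.tau ρ a z.1 z.2) (r, t) := by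
  set τ := Field.tau ρ a r t with hτ
  let f : (E3 × ℝ) × ℝ → ℝ := fun p => p.2 + ‖p.1.1 - ρ p.2‖ - p.1.2
  have hN : r - ρ τ ≠ 0 := h.sepVec_ne ht
  have hτa := h.tau_lt ht.1
  have hf : ContDiffAt ℝ n f ((r, t), τ) := by
    refine (contDiffAt_snd.add (ContDiffAt.norm ℝ ?_ hN)).sub (contDiffAt_snd.comp _ contDiffAt_fst)
    exact (contDiffAt_fst.comp _ contDiffAt_fst).sub
      (ContDiffAt.comp ((r, t), τ) (f := Prod.snd) (g := ρ) hρ contDiffAt_snd)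
  have hfd : DifferentiableAt ℝ f ((r, t), τ) := hf.differentiableAt hn
  have hpart : fderiv ℝ f ((r, t), τ) (0, 1) = 1 + -inner ℝ (r - ρ τ) (w τ) / ‖r - ρ τ‖ := by
    have h1 : HasDerivAt (fun σ : ℝ => (((r, t) : E3 × ℝ), σ)) (0, 1) τ :=
      (hasDerivAt_const _ _).prodMk (hasDerivAt_id _)
    have h2 := HasFDerivAt.comp_hasDerivAt τ hfd.hasFDerivAt h1
    have h3 : HasDerivAt (fun σ : ℝ => σ + ‖r - ρ σ‖ - t)
        (1 + -inner ℝ (r - ρ τ) (w τ) / ‖r - ρ τ‖) τ := by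
      have h4 : HasDerivWithinAt (fun σ => r - ρ σ) (-(w τ)) univ τ :=
        ((h.hasDerivAt hτa).const_sub r).hasDerivWithinAt
      have h5 := (hasDerivWithinAt_norm_of_ne h4 hN).hasDerivAt univ_mem
      rw [inner_neg_right] at h5
      exact ((hasDerivAt_id τ).add h5).sub_const t
    exact h2.unique h3
  have hpos : fderiv ℝ f ((r, t), τ) (0, 1) ≠ 0 := by
    have h1 := h.rate_pos ht
    have h2 : 0 < ‖r - ρ τ‖ := norm_pos_iff.2 hN
    rw [hpart]
    have : 0 < 1 + -inner ℝ (r - ρ τ) (w τ) / ‖r - ρ τ‖ := by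
      rw [neg_div, ← sub_eq_add_neg, sub_pos, div_lt_one h2]
      exact sub_pos.1 h1
    exact this.ne'
  have hinv : (fderiv ℝ f ((r, t), τ) ∘L .inr ℝ (E3 × ℝ) ℝ).IsInvertible := by
    refine ContinuousLinearMap.IsInvertible.of_inverse
      (g := (fderiv ℝ f ((r, t), τ) (0, 1))⁻¹ • ContinuousLinearMap.id ℝ ℝ) ?_ ?_
    · ext; simp [hpos]
    · ext; simp [hpos]
  refine (hf.contDiffAt_implicitFunction hn hinv).congr_of_eventuallyEq ?_
  have h0 : f ((r, t), τ) = 0 := by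
    have := (h.tau_spec ht.1.le).2
    simp only [f]; linarith
  have hT : Tendsto (hf.implicitFunction hn hinv) (𝓝 (r, t)) (𝓝 τ) := by
    have := (hf.contDiffAt_implicitFunction hn hinv).continuousAt.tendsto
    rwa [hf.implicitFunction_apply_self hn hinv] at this
  -- The implicit function also solves the retardation equation with values below `a`; uniqueness of
  -- the solution identifies it with `Field.tau`.
  filter_upwards [hf.eventually_apply_implicitFunction hn hinv, hT.eventually (Iio_mem_nhds hτa)]
    with z hz hz'
  refine h.tau_eq (le_of_lt hz') ?_
  rw [h0] at hz
  simp only [f] at hz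
  linarith

theorem eventually_offPath : ∀ᶠ z : E3 × ℝ in 𝓝 (r, t), OffPath ρ a z.1 z.2 := by
  have h1 := (h.contDiffAt_tau ht one_ne_zero (h.contDiffAt_one (h.tau_lt ht.1))).continuousAt
  have h2 : ContinuousAt (fun z : E3 × ℝ => z.2 - Field.tau ρ a z.1 z.2) (r, t) :=
    continuousAt_snd.sub h1
  filter_upwards [eventually_mem r t ht.1, h2.eventually (lt_mem_nhds (sub_pos.2 ht.2))]
    with z hz hz' using ⟨hz, sub_pos.1 hz'⟩

theorem eventually_offPath_time : ∀ᶠ t' in 𝓝 t, OffPath ρ a r t' :=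
  (show ContinuousAt (fun t' : ℝ => ((r, t') : E3 × ℝ)) t by fun_prop).eventually
    (h.eventually_offPath ht)

end

section curve

variable (h : IsPath ρ w a κ A) {c : ℝ → E3} {v : E3} {S : Set ℝ} {t : ℝ}
  (ht : OffPath ρ a (c t) t) (hc : HasDerivWithinAt c v S t)
include h ht hc

theorem eventually_offPath_curve : ∀ᶠ t' in 𝓝[S] t, OffPath ρ a (c t') t' :=
  (show ContinuousWithinAt (fun t' : ℝ => ((c t', t') : E3 × ℝ)) S t from
    hc.continuousWithinAt.prodMk continuousWithinAt_id).eventually (h.eventually_offPath ht)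

theorem hasDerivWithinAt_tau (hS : UniqueDiffWithinAt ℝ S t) :
    HasDerivWithinAt (fun t' => Field.tau ρ a (c t') t')
      ((‖sepVec ρ a (c t) t‖ - inner ℝ (sepVec ρ a (c t) t) v) /
        (‖sepVec ρ a (c t) t‖ - inner ℝ (sepVec ρ a (c t) t) (retVel ρ w a (c t) t))) S t := by
  have hτa := h.tau_lt ht.1
  have h1 := ((h.contDiffAt_tau ht one_ne_zero (h.contDiffAt_one hτa)).differentiableAt
    one_ne_zero).hasFDerivAt
  have h2 : HasDerivWithinAt (fun t' => ((c t', t') : E3 × ℝ)) (v, 1) S t :=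
    hc.prodMk (hasDerivWithinAt_id t S)
  have h3 := HasFDerivAt.comp_hasDerivWithinAt (f := fun t' => ((c t', t') : E3 × ℝ)) t h1 h2
  set T' := (fderiv ℝ (fun z : E3 × ℝ => Field.tau ρ a z.1 z.2) (c t, t)) (v, 1) with hT'
  replace h3 : HasDerivWithinAt (fun t' => Field.tau ρ a (c t') t') T' S t := h3
  have h4 : HasDerivWithinAt (fun t' => sepVec ρ a (c t') t')
      (v - T' • retVel ρ w a (c t) t) S t :=
    hc.sub (HasDerivAt.scomp_hasDerivWithinAt t (h.hasDerivAt hτa) h3)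
  -- Differentiability is known, so the value `T'` follows from differentiating the identity `τ +
  -- ‖N‖ = t` along the curve and solving the resulting linear equation.
  have h5 := h3.add (hasDerivWithinAt_norm_of_ne h4 (h.sepVec_ne ht))
  have h6 := (hasDerivWithinAt_id t S).congr_of_eventuallyEq (f₁ := fun t' =>
    Field.tau ρ a (c t') t' + ‖sepVec ρ a (c t') t'‖) (by
      filter_upwards [h.eventually_offPath_curve ht hc] with t' ht'
      rw [h.norm_sepVec ht']; simp) (by rw [h.norm_sepVec ht]; simp)
  have h7 := hS.eq_deriv S h5 h6
  have hR := norm_pos_iff.2 (h.sepVec_ne ht)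
  have hr := h.rate_pos ht
  convert h3 using 1
  rw [div_eq_iff hr.ne']
  rw [inner_sub_right, inner_smul_right] at h7
  field_simp at h7
  linarith

theorem hasDerivWithinAt_sepVec (hS : UniqueDiffWithinAt ℝ S t) :
    HasDerivWithinAt (fun t' => sepVec ρ a (c t') t')
      (v - ((‖sepVec ρ a (c t) t‖ - inner ℝ (sepVec ρ a (c t) t) v) /
        (‖sepVec ρ a (c t) t‖ - inner ℝ (sepVec ρ a (c t) t) (retVel ρ w a (c t) t))) •
          retVel ρ w a (c t) t) S t :=
  hc.sub (HasDerivAt.scomp_hasDerivWithinAt t (h.hasDerivAt (h.tau_lt ht.1))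
    (h.hasDerivWithinAt_tau ht hc hS))

end curve

section fixed

variable (h : IsPath ρ w a κ A) {r : E3} {t : ℝ} (ht : OffPath ρ a r t)
include h ht

theorem hasDerivAt_sepVec :
    HasDerivAt (fun t' => sepVec ρ a r t')
      (-(tauRate (sepVec ρ a r t, retVel ρ w a r t) • retVel ρ w a r t)) t := by
  have := (h.hasDerivWithinAt_sepVec (c := fun _ => r) ht (hasDerivWithinAt_const t univ r)
    uniqueDiffWithinAt_univ).hasDerivAt univ_mem
  simpa [tauRate] using this

theorem hasDerivAt_e :
    HasDerivAt (fun t' => Field.e ρ a r t') (dirRate (sepVec ρ a r t, retVel ρ w a r t)) t := by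
  have h1 := ((contDiffAt_unitDir (n := 1) (h.sepVec_ne ht)).differentiableAt
    one_ne_zero).hasFDerivAt
  refine (HasFDerivAt.comp_hasDerivAt t h1 (h.hasDerivAt_sepVec ht)).congr_of_eventuallyEq ?_
  filter_upwards [h.eventually_offPath_time ht] with t' ht' using h.e_eq ht'

theorem hasDerivAt_coulomb :
    HasDerivAt (fun t' => Field.u ρ a r t' ^ 2 • Field.e ρ a r t')
      (coulombRate (sepVec ρ a r t, retVel ρ w a r t)) t := by
  have h1 := ((contDiffAt_coulomb (n := 1) (h.sepVec_ne ht)).differentiableAt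
    one_ne_zero).hasFDerivAt
  refine (HasFDerivAt.comp_hasDerivAt t h1 (h.hasDerivAt_sepVec ht)).congr_of_eventuallyEq ?_
  filter_upwards [h.eventually_offPath_time ht] with t' ht'
  rw [h.e_eq ht', h.u_eq ht']; rfl

theorem deriv_e_eventuallyEq :
    (deriv fun t' => Field.e ρ a r t') =ᶠ[𝓝 t]
      fun t' => dirRate (sepVec ρ a r t', retVel ρ w a r t') := by
  filter_upwards [h.eventually_offPath_time ht] with t' ht' using (h.hasDerivAt_e ht').deriv

/-- Separates the field by regularity: the first two terms of the formula depend only on the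
retarded position and velocity, and accelerations enter only through the second derivative of `e`.
-/
theorem newtonFeynman_eq :
    Field.newtonFeynman ρ a r t = nearField (sepVec ρ a r t, retVel ρ w a r t) +
      deriv (fun t' => dirRate (sepVec ρ a r t', retVel ρ w a r t')) t := by
  rw [Field.newtonFeynman, (h.hasDerivAt_coulomb ht).deriv, (h.deriv_e_eventuallyEq ht).deriv_eq,
    h.e_eq ht, h.u_eq ht, inv_inv]
  rfl

/-- The Lipschitz velocity already yields the first derivatives of `e` and `u² e` off the path; only
the second derivative of `e` can fail to exist. -/
theorem exists_iff :
    Field.Exists ρ a r t ↔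
      DifferentiableAt ℝ (fun t' => dirRate (sepVec ρ a r t', retVel ρ w a r t')) t := by
  rw [← (h.deriv_e_eventuallyEq ht).differentiableAt_iff]
  refine ⟨fun H => H.2.2, fun H => ⟨(h.hasDerivAt_coulomb ht).differentiableAt, ?_, H⟩⟩
  filter_upwards [h.eventually_offPath_time ht] with t' ht' using
    (h.hasDerivAt_e ht').differentiableAt

end fixed

section congr

variable (h : IsPath ρ w a κ A) {ρ' w' : ℝ → E3} {d κ' A' : ℝ} (h' : IsPath ρ' w' d κ' A')
  (hd : a ≤ d) (he : EqOn ρ' ρ (Iic a)) {r : E3} {t : ℝ} (ht : t < a + ‖r - ρ a‖)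
include h h' hd he ht

theorem e_eventuallyEq :
    (fun t' => Field.e ρ' d r t') =ᶠ[𝓝 t] fun t' => Field.e ρ a r t' := by
  filter_upwards [eventually_mem' r t ht] with t' ht' using h.e_congr h' hd he ht'.le

theorem coulomb_eventuallyEq :
    (fun t' => Field.u ρ' d r t' ^ 2 • Field.e ρ' d r t') =ᶠ[𝓝 t]
      fun t' => Field.u ρ a r t' ^ 2 • Field.e ρ a r t' := by
  filter_upwards [eventually_mem' r t ht] with t' ht'
  rw [h.e_congr h' hd he ht'.le, h.u_congr h' hd he ht'.le]

/-- At times near `t` the fixed point `r` still receives signals emitted up to time `a`, so neither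
the path after `a` nor the cut-off in `Field.tau` influences the field. -/
theorem newtonFeynman_congr : Field.newtonFeynman ρ' d r t = Field.newtonFeynman ρ a r t := by
  rw [Field.newtonFeynman, Field.newtonFeynman, (h.coulomb_eventuallyEq h' hd he ht).deriv_eq,
    (h.e_eventuallyEq h' hd he ht).deriv.deriv_eq, h.e_congr h' hd he ht.le,
    h.u_congr h' hd he ht.le]

theorem exists_congr : Field.Exists ρ' d r t ↔ Field.Exists ρ a r t := by
  rw [Field.Exists, Field.Exists, (h.coulomb_eventuallyEq h' hd he ht).differentiableAt_iff,
    (h.e_eventuallyEq h' hd he ht).deriv.differentiableAt_iff]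
  refine and_congr_right fun _ => and_congr_left fun _ => ?_
  refine eventually_congr ?_
  filter_upwards [(h.e_eventuallyEq h' hd he ht).eventuallyEq_nhds] with t' ht'
  exact ht'.differentiableAt_iff

end congr
end IsPath

/-! ### Bounds for derivatives along Lipschitz curves -/

theorem HasDerivWithinAt.norm_le_of_eventually {E : Type*} [NormedAddCommGroup E] [NormedSpace ℝ E]
    {f : ℝ → E} {f' : E} {S : Set ℝ} {t C : ℝ}
    (hf : HasDerivWithinAt f f' S t) (hS : UniqueDiffWithinAt ℝ S t)
    (hC : ∀ᶠ t' in 𝓝[S] t, ‖f t' - f t‖ ≤ C * |t' - t|) : ‖f'‖ ≤ C := by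
  have h1 := hasDerivWithinAt_iff_tendsto_slope.1 hf
  have : NeBot (𝓝[S \ {t}] t) :=
    accPt_principal_iff_nhdsWithin.1 (uniqueDiffWithinAt_iff_accPt.1 hS)
  refine le_of_tendsto h1.norm ?_
  filter_upwards [nhdsWithin_mono t sdiff_subset hC, self_mem_nhdsWithin] with t' h2 h3
  have h4 : 0 < |t' - t| := abs_pos.2 (sub_ne_zero.2 h3.2)
  rw [slope_def_module, norm_smul, norm_inv, Real.norm_eq_abs, inv_mul_le_iff₀ h4, mul_comm]
  exact h2

theorem ContDiffAt.exists_norm_sub_le {E F : Type*} [NormedAddCommGroup E] [NormedSpace ℝ E]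
    [NormedAddCommGroup F] [NormedSpace ℝ F] {f : E → F} {p : E} (hf : ContDiffAt ℝ 1 f p) :
    ∃ C, 0 ≤ C ∧ ∃ U ∈ 𝓝 p, ∀ x ∈ U, ∀ y ∈ U, ‖f x - f y‖ ≤ C * ‖x - y‖ := by
  obtain ⟨K, U, hU, hK⟩ := hf.exists_lipschitzOnWith
  refine ⟨K, K.2, U, hU, fun x hx y hy => ?_⟩
  simpa [dist_eq_norm] using hK.dist_le_mul x hx y hy

/-- Derivatives of a smooth function along a Lipschitz curve are bounded. -/
theorem ContDiffAt.exists_bound_deriv_comp {E F : Type*} [NormedAddCommGroup E] [NormedSpace ℝ E]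
    [NormedAddCommGroup F] [NormedSpace ℝ F] {f : E → F} {φ : ℝ → E} {S : Set ℝ} {a L : ℝ}
    (hf : ContDiffAt ℝ 1 f (φ a)) (hS : UniqueDiffOn ℝ S) (hφ : ContinuousWithinAt φ S a)
    (hL : ∀ᶠ t in 𝓝[S] a, ∀ᶠ t' in 𝓝[S] t, ‖φ t' - φ t‖ ≤ L * |t' - t|) :
    ∃ C, 0 ≤ C ∧ ∀ᶠ t in 𝓝[S] a, ∀ d, HasDerivWithinAt (fun t => f (φ t)) d S t → ‖d‖ ≤ C := by
  obtain ⟨C, hC0, U, hU, hC⟩ := hf.exists_norm_sub_le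
  have hφU : ∀ᶠ t in 𝓝[S] a, φ t ∈ U := hφ hU
  refine ⟨|C * L|, abs_nonneg _, ?_⟩
  filter_upwards [hL, hφU, eventually_eventually_nhdsWithin.2 hφU, self_mem_nhdsWithin]
    with t h1 h2 h3 htS d hd
  refine (hd.norm_le_of_eventually (C := C * L) (hS t htS) ?_).trans (le_abs_self _)
  filter_upwards [h1, h3] with t' h4 h5
  rw [mul_assoc]
  exact (hC _ h5 _ h2).trans (mul_le_mul_of_nonneg_left h4 hC0)

/-! ### The force as a smooth operator acting on the field -/

/-- The cross product as a continuous bilinear map. -/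
def crossL : E3 →L[ℝ] E3 →L[ℝ] E3 :=
  IsBilinearMap.toContinuousBilinearMap (𝕜 := ℝ) (f := cross)
    { add_left := fun x y z => by simp [cross]
      smul_left := fun x y z => by simp [cross]
      add_right := fun x y z => by simp [cross]
      smul_right := fun x y z => by simp [cross] }

/-- The operator `h ↦ q (h + v × (e × h)) - m h`, where `e` is the direction of `N`. -/
def forceOp (q m : ℝ) (p : E3 × E3) : E3 →L[ℝ] E3 :=
  q • (ContinuousLinearMap.id ℝ E3 + (crossL p.2).comp (crossL (unitDir p.1)))
    - m • ContinuousLinearMap.id ℝ E3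

/-- The force operator divided by the Doppler factor. -/
def dopplerOp (q m : ℝ) (p : E3 × E3) : E3 →L[ℝ] E3 :=
  (1 - inner ℝ (unitDir p.1) p.2)⁻¹ • forceOp q m p

/-- The part of the force that does not contain accelerations; the arguments are the vector from the
retarded position, the retarded velocity, and the present velocity. -/
def nearForce (q m : ℝ) (p : (E3 × E3) × E3) : E3 :=
  forceOp q m (p.1.1, p.2) (nearField p.1) -
    dopplerOp q m (p.1.1, p.2) (fderiv ℝ dirRate p.1 (p.2, 0))

theorem forceOp_apply (q m : ℝ) (p : E3 × E3) (x : E3) :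
    forceOp q m p x = q • (x + cross p.2 (cross (unitDir p.1) x)) - m • x := rfl

theorem doppler_pos {p : E3 × E3} (hN : p.1 ≠ 0) (hv : ‖p.2‖ < 1) :
    0 < 1 - inner ℝ (unitDir p.1) p.2 := by
  have h1 := norm_sub_inner_pos hN hv
  have h2 : 0 < ‖p.1‖ := norm_pos_iff.2 hN
  rw [unitDir, real_inner_smul_left, sub_pos, inv_mul_lt_iff₀ h2, mul_one]
  exact sub_pos.1 h1

section smooth

variable {n : WithTop ℕ∞} (q m : ℝ)

theorem contDiffAt_forceOp {p : E3 × E3} (hN : p.1 ≠ 0) : ContDiffAt ℝ n (forceOp q m) p := by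
  have h1 : ContDiffAt ℝ n (fun p : E3 × E3 => unitDir p.1) p :=
    (contDiffAt_unitDir hN).comp p contDiffAt_fst
  have h2 : ContDiffAt ℝ n (fun p : E3 × E3 => crossL (unitDir p.1)) p :=
    crossL.contDiff.contDiffAt.comp p h1
  have h3 : ContDiffAt ℝ n (fun p : E3 × E3 => crossL p.2) p :=
    crossL.contDiff.contDiffAt.comp p contDiffAt_snd
  exact ((contDiffAt_const.add (h3.clm_comp h2)).const_smul q).sub contDiffAt_const

theorem contDiffAt_dopplerOp {p : E3 × E3} (hN : p.1 ≠ 0) (hv : ‖p.2‖ < 1) :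
    ContDiffAt ℝ n (dopplerOp q m) p := by
  have h1 : ContDiffAt ℝ n (fun p : E3 × E3 => unitDir p.1) p :=
    (contDiffAt_unitDir hN).comp p contDiffAt_fst
  exact ((contDiffAt_const.sub (h1.inner ℝ contDiffAt_snd)).inv (doppler_pos hN hv).ne').smul
    (contDiffAt_forceOp q m hN)

theorem contDiffAt_nearForce {p : (E3 × E3) × E3} (hN : p.1.1 ≠ 0) (hV : ‖p.1.2‖ < 1)
    (hv : ‖p.2‖ < 1) : ContDiffAt ℝ 1 (nearForce q m) p := by
  have h1 : ContDiffAt ℝ 1 (fun p : (E3 × E3) × E3 => ((p.1.1, p.2) : E3 × E3)) p := by fun_prop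
  have h2 : ContDiffAt ℝ 1 (fun p : (E3 × E3) × E3 => nearField p.1) p :=
    ((contDiffAt_nearField hN hV).of_le one_le_two).comp p contDiffAt_fst
  have h3 : ContDiffAt ℝ 1 (fun p : (E3 × E3) × E3 => fderiv ℝ dirRate p.1) p :=
    ((contDiffAt_dirRate hN hV).fderiv_right (by norm_num)).comp p contDiffAt_fst
  exact (((contDiffAt_forceOp q m (p := (p.1.1, p.2)) hN).comp p h1).clm_apply h2).sub
    (((contDiffAt_dopplerOp q m (p := (p.1.1, p.2)) hN hv).comp p h1).clm_apply
      (h3.clm_apply (contDiffAt_snd.prodMk contDiffAt_const)))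

end smooth

/-! ### The field along the curve of another body -/

namespace IsPath

variable {ρ w : ℝ → E3} {a κ A : ℝ}

/-- The vector from the retarded position, and the retarded velocity. -/
def retState (ρ w : ℝ → E3) (a : ℝ) (r : E3) (t : ℝ) : E3 × E3 :=
  (sepVec ρ a r t, retVel ρ w a r t)

theorem exists_retState_lip (h : IsPath ρ w a κ A) : ∃ C, 0 ≤ C ∧ ∀ r r' t t',
    t ≤ a + ‖r - ρ a‖ → t' ≤ a + ‖r' - ρ a‖ →
    ‖retState ρ w a r t - retState ρ w a r' t'‖ ≤ C * (|t - t'| + ‖r - r'‖) := by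
  have hκ : 0 < 1 - κ := by linarith [h.lt_one]
  have h0 := h.nonneg
  refine ⟨1 + (κ + |A|) * (1 - κ)⁻¹, by positivity, fun r r' t t' ht ht' => ?_⟩
  have h1 := h.tau_lip ht ht'
  have h2 := h.pos_lip _ (h.tau_spec ht).1 _ (h.tau_spec ht').1
  have h3 := (h.vel_lip _ (h.tau_spec ht).1 _ (h.tau_spec ht').1).trans
    (mul_le_mul_of_nonneg_right (le_abs_self A) (abs_nonneg _))
  set X := |t - t'| + ‖r - r'‖ with hX
  have hX0 : 0 ≤ X := by positivity
  have hXr : ‖r - r'‖ ≤ X := by rw [hX]; linarith [abs_nonneg (t - t')]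
  have h4 := mul_le_mul_of_nonneg_left h1 h0
  have h5 := mul_le_mul_of_nonneg_left h1 (abs_nonneg A)
  have h6 : 0 ≤ κ * ((1 - κ)⁻¹ * X) := by positivity
  have h7 : 0 ≤ |A| * ((1 - κ)⁻¹ * X) := by positivity
  refine max_le ?_ ?_
  · have : ‖sepVec ρ a r t - sepVec ρ a r' t'‖ ≤
        ‖r - r'‖ + ‖ρ (Field.tau ρ a r t) - ρ (Field.tau ρ a r' t')‖ := by
      rw [sepVec, sepVec, sub_sub_sub_comm]
      exact norm_sub_le _ _
    simp only [retState, Prod.fst_sub]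
    nlinarith
  · simp only [retState, Prod.snd_sub, retVel]
    nlinarith

section curve

variable (h : IsPath ρ w a κ A) {c : ℝ → E3} {v : E3} {S : Set ℝ} {t : ℝ}
  (ht : OffPath ρ a (c t) t) (hc : HasDerivWithinAt c v S t) (hS : UniqueDiffWithinAt ℝ S t)
include h ht hc hS

/-- The derivative of `dirRate` along a curve, if its partial time derivative exists. -/
theorem hasDerivWithinAt_dirRate
    (hX : DifferentiableAt ℝ (fun t' => dirRate (retState ρ w a (c t) t')) t) :
    HasDerivWithinAt (fun t' => dirRate (retState ρ w a (c t') t'))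
      ((1 - inner ℝ (unitDir (sepVec ρ a (c t) t)) v) •
          deriv (fun t' => dirRate (retState ρ w a (c t) t')) t +
        fderiv ℝ dirRate (retState ρ w a (c t) t) (v, 0)) S t := by
  have hτa := h.tau_lt ht.1
  have hN := h.sepVec_ne ht
  have hR := norm_pos_iff.2 hN
  have hrate := h.rate_pos ht
  set r := c t with hr
  set τ := Field.tau ρ a r t with hτ
  set T : ℝ → ℝ := fun t' => Field.tau ρ a (c t') t' with hT
  have hTd := h.hasDerivWithinAt_tau ht hc hS
  have hTc : Tendsto T (𝓝[S] t) (𝓝 τ) := hTd.continuousWithinAt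
  have hTa : ∀ᶠ t' in 𝓝[S] t, T t' < a := hTc.eventually (Iio_mem_nhds hτa)
  -- The time at which the signal emitted at `T t'` arrives at the fixed point `r`. In this
  -- parameter the fixed point sees the same retarded positions and velocities as the moving curve,
  -- and the derivative of `sg` is the Doppler factor.
  set sg : ℝ → ℝ := fun t' => T t' + ‖r - ρ (T t')‖ with hsg
  have hsgt : sg t = t := by
    have := (h.tau_spec ht.1.le).2
    simp only [hsg, hT]; linarith
  have hsgd : HasDerivWithinAt sg (1 - inner ℝ (unitDir (sepVec ρ a r t)) v) S t := by
    have h1 : HasDerivWithinAt (fun t' => r - ρ (T t')) _ S t :=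
      (HasDerivAt.scomp_hasDerivWithinAt t (h.hasDerivAt hτa) hTd).const_sub r
    have h2 := hTd.add (hasDerivWithinAt_norm_of_ne h1 hN)
    refine h2.congr_deriv ?_
    change _ + inner ℝ (sepVec ρ a r t) _ / ‖sepVec ρ a r t‖ = _
    rw [unitDir, real_inner_smul_left, inner_neg_right, inner_smul_right]
    change _ + -(_ * inner ℝ (sepVec ρ a r t) (retVel ρ w a r t)) / ‖sepVec ρ a r t‖ = _
    rw [← hr]
    field_simp
    ring
  have hcomp : ∀ᶠ t' in 𝓝[S] t, retState ρ w a r (sg t') = (r - ρ (T t'), w (T t')) := by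
    filter_upwards [hTa] with t' h1
    have : Field.tau ρ a r (sg t') = T t' := h.tau_eq h1.le (by simp [hsg])
    rw [retState, sepVec, retVel, this]
  have h1 : HasDerivWithinAt (fun t' => dirRate (r - ρ (T t'), w (T t')))
      ((1 - inner ℝ (unitDir (sepVec ρ a r t)) v) •
        deriv (fun t' => dirRate (retState ρ w a r t')) t) S t := by
    have h2 := hX.hasDerivAt
    rw [← hsgt] at h2
    have h3 := HasDerivAt.scomp_hasDerivWithinAt t h2 hsgd
    rw [hsgt] at h3
    refine h3.congr_of_eventuallyEq ?_ ?_
    · filter_upwards [hcomp] with t' ht'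
      simp [Function.comp, ht']
    · simp only [Function.comp, hsgt]; rfl
  set L := fderiv ℝ dirRate (retState ρ w a r t) with hL
  -- Replacing `r` by `c t'` changes only the first argument, but the velocity `w (T t')` is merely
  -- continuous in `t'`, so the chain rule does not apply to either term. Strict differentiability
  -- compares two arguments that move together.
  have hstrict : HasStrictFDerivAt dirRate L (retState ρ w a r t) :=
    (contDiffAt_dirRate (p := retState ρ w a r t) hN (h.norm_retVel_lt ht)).hasStrictFDerivAt
      two_ne_zero
  have hcont2 : Tendsto (fun t' => w (T t')) (𝓝[S] t) (𝓝 (w τ)) :=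
    (h.continuousAt_vel hτa).tendsto.comp hTc
  have hcont1 : Tendsto (fun t' => ρ (T t')) (𝓝[S] t) (𝓝 (ρ τ)) :=
    (h.hasDerivAt hτa).continuousAt.tendsto.comp hTc
  have hcc : Tendsto c (𝓝[S] t) (𝓝 r) := hc.continuousWithinAt
  have hpair : Tendsto (fun t' => (((c t' - ρ (T t'), w (T t')) : E3 × E3),
      ((r - ρ (T t'), w (T t')) : E3 × E3))) (𝓝[S] t)
      (𝓝 (retState ρ w a r t, retState ρ w a r t)) :=
    ((hcc.sub hcont1).prodMk_nhds hcont2).prodMk_nhds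
      ((tendsto_const_nhds.sub hcont1).prodMk_nhds hcont2)
  have hO := hstrict.isLittleO.comp_tendsto hpair
  have hO2 : (fun t' => dirRate (c t' - ρ (T t'), w (T t')) - dirRate (r - ρ (T t'), w (T t')) -
      L (c t' - r, 0)) =o[𝓝[S] t] fun t' => t' - t := by
    have h2 : (fun t' => ((c t' - r, 0) : E3 × E3)) =O[𝓝[S] t] fun t' => t' - t := by
      have := hc.hasFDerivWithinAt.isBigO_sub
      exact this.prod_left (Asymptotics.isBigO_zero _ _)
    refine Asymptotics.IsLittleO.trans_isBigO (hO.congr (fun t' => ?_) (fun t' => ?_)) h2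
    · simp [Function.comp]
    · simp [Function.comp]
  have h2 : HasDerivWithinAt (fun t' => dirRate (c t' - ρ (T t'), w (T t')) -
      dirRate (r - ρ (T t'), w (T t')) - L (c t' - r, 0)) 0 S t := by
    rw [hasDerivWithinAt_iff_isLittleO]
    refine hO2.congr_left fun t' => ?_
    have : L (0, 0) = 0 := L.map_zero
    simp [← hr, this]
  have h3 : HasDerivWithinAt (fun t' => L (c t' - r, 0)) (L (v, 0)) S t :=
    L.hasFDerivAt.comp_hasDerivWithinAt t ((hc.sub_const r).prodMk (hasDerivWithinAt_const t S 0))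
  have h4 := ((h2.add h3).add h1).congr_deriv (g' := (1 - inner ℝ (unitDir (sepVec ρ a r t)) v) •
    deriv (fun t' => dirRate (retState ρ w a r t')) t + L (v, 0)) (by rw [zero_add, add_comm])
  refine h4.congr_of_eventuallyEq (Eventually.of_forall fun t' => ?_) ?_
  · simp [retState, sepVec, retVel, hT]
  · simp [retState, sepVec, retVel, hT, ← hr]

/-- Along a curve, the force is the sum of a smooth function of the retarded state and an operator
applied to the derivative of a Lipschitz function. -/
theorem forceOp_newtonFeynman_eq (q m : ℝ) (hv : ‖v‖ < 1) (hX : Field.Exists ρ a (c t) t) :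
    ∃ G', HasDerivWithinAt (fun t' => dirRate (retState ρ w a (c t') t')) G' S t ∧
      forceOp q m (sepVec ρ a (c t) t, v) (Field.newtonFeynman ρ a (c t) t) =
        nearForce q m (retState ρ w a (c t) t, v) +
          dopplerOp q m (sepVec ρ a (c t) t, v) G' := by
  have hpos := doppler_pos (p := (sepVec ρ a (c t) t, v)) (h.sepVec_ne ht) hv
  refine ⟨_, h.hasDerivWithinAt_dirRate ht hc hS ((h.exists_iff ht).1 hX), ?_⟩
  -- The total derivative is solved for the partial time derivative; dividing by the Doppler factor
  -- turns `forceOp` into `dopplerOp`, and the term with `(v, 0)` goes into `nearForce`.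
  rw [h.newtonFeynman_eq ht, nearForce, map_add, map_add]
  simp only [dopplerOp, smul_apply, map_smul, smul_smul]
  rw [mul_inv_cancel₀ hpos.ne', one_smul]
  simp only [retState]
  abel

end curve

end IsPath

/-! ### Comparison of the forces on two curves -/

namespace IsPath

variable {ρ w : ℝ → E3} {a κ A : ℝ}

theorem norm_vel_le' (h : IsPath ρ w a κ A) {t : ℝ} (ht : t ≤ a) : ‖w t‖ ≤ κ := by
  refine (h.hasDeriv t ht).norm_le_of_eventually (uniqueDiffOn_Iic a t ht) ?_
  filter_upwards [self_mem_nhdsWithin] with t' ht' using h.pos_lip t' ht' t ht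

theorem mono_const (h : IsPath ρ w a κ A) {κ' A' : ℝ} (h1 : κ ≤ κ') (h2 : κ' < 1) (h3 : A ≤ A') :
    IsPath ρ w a κ' A' where
  nonneg := h.nonneg.trans h1
  lt_one := h2
  pos_lip t ht t' ht' := (h.pos_lip t ht t' ht').trans (by gcongr)
  hasDeriv := h.hasDeriv
  vel_lip t ht t' ht' := (h.vel_lip t ht t' ht').trans (by gcongr)

theorem continuousOn_vel (h : IsPath ρ w a κ A) : ContinuousOn w (Iic a) := by
  have : LipschitzOnWith (Real.toNNReal |A|) w (Iic a) := by
    refine LipschitzOnWith.of_dist_le_mul fun t ht t' ht' => ?_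
    rw [dist_eq_norm, Real.dist_eq, Real.coe_toNNReal _ (abs_nonneg A)]
    exact (h.vel_lip t ht t' ht').trans
      (mul_le_mul_of_nonneg_right (le_abs_self A) (abs_nonneg _))
  exact this.continuousOn

/-- The retarded state along a curve is Lipschitz. -/
theorem retState_curve (h : IsPath ρ w a κ A) {C₀ : ℝ} (hC₀ : 0 ≤ C₀)
    (hret : ∀ r r' t t', t ≤ a + ‖r - ρ a‖ → t' ≤ a + ‖r' - ρ a‖ →
      ‖retState ρ w a r t - retState ρ w a r' t'‖ ≤ C₀ * (|t - t'| + ‖r - r'‖))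
    {b : ℝ} (hab : a < b) {c v : ℝ → E3} (hcv : IsPath c v b κ A) (hcne : c a ≠ ρ a) :
    (∀ᶠ t in 𝓝[Icc a b] a, OffPath ρ a (c t) t) ∧
    ContinuousWithinAt (fun t => retState ρ w a (c t) t) (Icc a b) a ∧
    (∀ᶠ t in 𝓝[Icc a b] a, ∀ᶠ t' in 𝓝[Icc a b] t,
      ‖retState ρ w a (c t') t' - retState ρ w a (c t) t‖ ≤ (C₀ * (1 + κ)) * |t' - t|) := by
  set S := Icc a b with hS
  have haS : a ∈ S := ⟨le_rfl, hab.le⟩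
  have hSb : S ⊆ Iic b := fun t ht => ht.2
  have hκ0 := h.nonneg
  have hcd : ∀ t ∈ S, HasDerivWithinAt c (v t) S t := fun t ht =>
    (hcv.hasDeriv t ht.2).mono hSb
  have hoff : OffPath ρ a (c a) a := h.offPath_of_le le_rfl
    (by have := norm_pos_iff.2 (sub_ne_zero.2 hcne); linarith)
  have hev := h.eventually_offPath_curve hoff (hcd a haS)
  have hl : ∀ t ∈ S, OffPath ρ a (c t) t → ∀ᶠ t' in 𝓝[S] t,
      ‖retState ρ w a (c t') t' - retState ρ w a (c t) t‖ ≤ (C₀ * (1 + κ)) * |t' - t| := by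
    intro t htS ht
    filter_upwards [h.eventually_offPath_curve ht (hcd t htS), self_mem_nhdsWithin]
      with t' ht' htS'
    refine (hret _ _ _ _ ht'.1.le ht.1.le).trans ?_
    have := hcv.pos_lip t' htS'.2 t htS.2
    rw [mul_assoc]
    gcongr
    linarith
  refine ⟨hev, ?_, ?_⟩
  · rw [ContinuousWithinAt, tendsto_iff_norm_sub_tendsto_zero]
    refine squeeze_zero' (Eventually.of_forall fun _ => norm_nonneg _) (hl a haS hoff) ?_
    have : Continuous fun t' => (C₀ * (1 + κ)) * |t' - a| := by fun_prop
    simpa using (this.tendsto a).mono_left nhdsWithin_le_nhds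
  · filter_upwards [hev, self_mem_nhdsWithin] with t ht htS using hl t htS ht

set_option maxHeartbeats 1000000 in
/-- The accelerations in the fields on two curves that start at the same state can be
absorbed, up to a Lipschitz error, into the derivative of a function that is Lipschitz in the
difference of the positions. -/
theorem exists_compensator (h : IsPath ρ w a κ A) (q m : ℝ) {b : ℝ} (hab : a < b)
    {c₁ v₁ c₂ v₂ : ℝ → E3} (h₁ : IsPath c₁ v₁ b κ A) (h₂ : IsPath c₂ v₂ b κ A)
    (hc : c₁ a = c₂ a) (hv : v₁ a = v₂ a) (hne : c₂ a ≠ ρ a)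
    (hv₂ : ∀ t ∈ Icc a b, DifferentiableWithinAt ℝ v₂ (Icc a b) t)
    (hX₁ : ∀ᶠ t in 𝓝[Icc a b] a, Field.Exists ρ a (c₁ t) t)
    (hX₂ : ∀ᶠ t in 𝓝[Icc a b] a, Field.Exists ρ a (c₂ t) t) :
    ∃ (C : ℝ) (Δ Δ' : ℝ → E3), 0 ≤ C ∧ Δ a = 0 ∧ ∀ᶠ t in 𝓝[Icc a b] a,
      HasDerivWithinAt Δ (Δ' t) (Icc a b) t ∧
      ‖forceOp q m (sepVec ρ a (c₁ t) t, v₁ t) (Field.newtonFeynman ρ a (c₁ t) t) -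
        forceOp q m (sepVec ρ a (c₂ t) t, v₂ t) (Field.newtonFeynman ρ a (c₂ t) t) - Δ' t‖ ≤
          C * (‖c₁ t - c₂ t‖ + ‖v₁ t - v₂ t‖) ∧
      ‖Δ t‖ ≤ C * ‖c₁ t - c₂ t‖ := by
  set S := Icc a b with hS
  have hSu : UniqueDiffOn ℝ S := uniqueDiffOn_Icc hab
  have haS : a ∈ S := ⟨le_rfl, hab.le⟩
  have hSb : S ⊆ Iic b := fun t ht => ht.2
  have hκ0 := h.nonneg
  obtain ⟨C₀, hC₀, hret⟩ := h.exists_retState_lip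
  have key := fun (c v : ℝ → E3) (hcv : IsPath c v b κ A) (hcne : c a ≠ ρ a) =>
    h.retState_curve hC₀ hret hab hcv hcne
  have hne₁ : c₁ a ≠ ρ a := hc ▸ hne
  obtain ⟨hoff₁, hz₁c, hz₁l⟩ := key c₁ v₁ h₁ hne₁
  obtain ⟨hoff₂, hz₂c, hz₂l⟩ := key c₂ v₂ h₂ hne
  set z₁ : ℝ → E3 × E3 := fun t => retState ρ w a (c₁ t) t with hz₁
  set z₂ : ℝ → E3 × E3 := fun t => retState ρ w a (c₂ t) t with hz₂
  have hz12 : z₁ a = z₂ a := by simp only [hz₁, hz₂, hc]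
  have hoffa := hoff₂.self_of_nhdsWithin haS
  have hN : (z₂ a).1 ≠ 0 := h.sepVec_ne hoffa
  have hV : ‖(z₂ a).2‖ < 1 := h.norm_retVel_lt hoffa
  have hva : ‖v₂ a‖ < 1 := (h₂.norm_vel_le' hab.le).trans_lt h.lt_one
  have hv₁c : ContinuousWithinAt v₁ S a := (h₁.continuousOn_vel a hab.le).mono hSb
  have hv₂c : ContinuousWithinAt v₂ S a := (h₂.continuousOn_vel a hab.le).mono hSb
  set n₂ : ℝ → E3 × E3 := fun t => ((z₂ t).1, v₂ t) with hn₂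
  set n₁ : ℝ → E3 × E3 := fun t => ((z₁ t).1, v₁ t) with hn₁
  have hg : ContDiffAt ℝ 1 dirRate (z₂ a) := (contDiffAt_dirRate hN hV).of_le one_le_two
  have hB : ContDiffAt ℝ 1 (dopplerOp q m) (n₂ a) := contDiffAt_dopplerOp q m hN hva
  have hΛ : ContDiffAt ℝ 1 (nearForce q m) (z₂ a, v₂ a) := contDiffAt_nearForce q m hN hV hva
  have hn₂c : ContinuousWithinAt n₂ S a := hz₂c.fst.prodMk hv₂c
  have hn₁c : ContinuousWithinAt n₁ S a := hz₁c.fst.prodMk hv₁c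
  have hn12 : n₁ a = n₂ a := by simp only [hn₁, hn₂, hz12, hv]
  obtain ⟨D₁, hD₁, hG'⟩ := ContDiffAt.exists_bound_deriv_comp (φ := z₁) (hz12 ▸ hg) hSu hz₁c hz₁l
  have hn₂l : ∀ᶠ t in 𝓝[S] a, ∀ᶠ t' in 𝓝[S] t,
      ‖n₂ t' - n₂ t‖ ≤ max (C₀ * (1 + κ)) A * |t' - t| := by
    filter_upwards [hz₂l, self_mem_nhdsWithin] with t ht htS
    filter_upwards [ht, self_mem_nhdsWithin] with t' ht' htS'
    refine max_le ?_ ?_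
    · refine ((norm_fst_le _).trans ht').trans ?_
      gcongr
      exact le_max_left _ _
    · refine (h₂.vel_lip t' htS'.2 t htS.2).trans ?_
      gcongr
      exact le_max_right _ _
  obtain ⟨D₂, hD₂, hK'⟩ := ContDiffAt.exists_bound_deriv_comp (φ := n₂) hB hSu hn₂c hn₂l
  obtain ⟨Cg, hCg, Ug, hUg, hgl⟩ := hg.exists_norm_sub_le
  obtain ⟨CB, hCB, UB, hUB, hBl⟩ := hB.exists_norm_sub_le
  obtain ⟨CΛ, hCΛ, UΛ, hUΛ, hΛl⟩ := hΛ.exists_norm_sub_le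
  have hBbd : ∀ᶠ t in 𝓝[S] a, ‖dopplerOp q m (n₂ t)‖ < ‖dopplerOp q m (n₂ a)‖ + 1 :=
    (hB.continuousAt.comp_continuousWithinAt hn₂c).norm.eventually
      (gt_mem_nhds (lt_add_one _))
  set CK := ‖dopplerOp q m (n₂ a)‖ + 1 with hCK
  have hCK0 : 0 ≤ CK := by positivity
  have hBdiff : ∀ᶠ t in 𝓝[S] a, DifferentiableAt ℝ (dopplerOp q m) (n₂ t) := by
    have : ∀ᶠ p in 𝓝 (n₂ a), DifferentiableAt ℝ (dopplerOp q m) p :=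
      (hB.eventually (by simp)).mono fun p hp => hp.differentiableAt one_ne_zero
    exact hn₂c.eventually this
  have hUg₁ : ∀ᶠ t in 𝓝[S] a, z₁ t ∈ Ug := hz₁c (by rw [hz12]; exact hUg)
  have hUg₂ : ∀ᶠ t in 𝓝[S] a, z₂ t ∈ Ug := hz₂c hUg
  have hUB₁ : ∀ᶠ t in 𝓝[S] a, n₁ t ∈ UB := hn₁c (by rw [hn12]; exact hUB)
  have hUB₂ : ∀ᶠ t in 𝓝[S] a, n₂ t ∈ UB := hn₂c hUB
  have hUΛ₁ : ∀ᶠ t in 𝓝[S] a, (z₁ t, v₁ t) ∈ UΛ :=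
    (hz₁c.prodMk hv₁c) (by simpa only [hz12, hv] using hUΛ)
  have hUΛ₂ : ∀ᶠ t in 𝓝[S] a, (z₂ t, v₂ t) ∈ UΛ := (hz₂c.prodMk hv₂c) hUΛ
  set G₁ : ℝ → E3 := fun t => dirRate (z₁ t) with hG₁
  set G₂ : ℝ → E3 := fun t => dirRate (z₂ t) with hG₂
  set K₂ : ℝ → E3 →L[ℝ] E3 := fun t => dopplerOp q m (n₂ t) with hK₂
  -- The witness is `Δ = B(n₂) (G₁ - G₂)`, which vanishes at `a` because the curves start at the
  -- same point. The summands of the constant bound, in turn, the change of `nearForce`, the change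
  -- of the Doppler operator applied to `G₁'`, the derivative of the operator applied to `G₁ - G₂`,
  -- and `Δ` itself.
  refine ⟨CΛ * (C₀ + 1) + CB * (C₀ + 1) * D₁ + D₂ * (Cg * C₀) + CK * (Cg * C₀),
    fun t => K₂ t (G₁ t - G₂ t), fun t => derivWithin (fun t => K₂ t (G₁ t - G₂ t)) S t,
    by positivity, by simp [hG₁, hG₂, hz12], ?_⟩
  filter_upwards [hoff₁, hoff₂, hX₁, hX₂, hG', hK', hBbd, hBdiff, hUg₁, hUg₂, hUB₁, hUB₂, hUΛ₁,
    hUΛ₂, self_mem_nhdsWithin] with t ho₁ ho₂ hx₁ hx₂ hbG hbK hbB hdB u₁ u₂ u₃ u₄ u₅ u₆ htS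
  have hcd₁ := (h₁.hasDeriv t htS.2).mono hSb
  have hcd₂ := (h₂.hasDeriv t htS.2).mono hSb
  obtain ⟨G₁', hdG₁, hf₁⟩ := h.forceOp_newtonFeynman_eq ho₁ hcd₁ (hSu t htS) q m
    ((h₁.norm_vel_le' htS.2).trans_lt h.lt_one) hx₁
  obtain ⟨G₂', hdG₂, hf₂⟩ := h.forceOp_newtonFeynman_eq ho₂ hcd₂ (hSu t htS) q m
    ((h₂.norm_vel_le' htS.2).trans_lt h.lt_one) hx₂
  have hn₂d : HasDerivWithinAt n₂ _ S t :=
    (h.hasDerivWithinAt_sepVec ho₂ hcd₂ (hSu t htS)).prodMk (hv₂ t htS).hasDerivWithinAt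
  have hK₂d : HasDerivWithinAt K₂ _ S t := hdB.hasFDerivAt.comp_hasDerivWithinAt t hn₂d
  have hbK₂ := hbK _ hK₂d
  have hbG₁ := hbG _ hdG₁
  set K₂' := fderiv ℝ (dopplerOp q m) (n₂ t) _ with hK₂'
  have hΔ := hK₂d.clm_apply (hdG₁.sub hdG₂)
  have hz : ‖z₁ t - z₂ t‖ ≤ C₀ * ‖c₁ t - c₂ t‖ := by
    simpa using hret _ _ _ _ ho₁.1.le ho₂.1.le
  set dc := ‖c₁ t - c₂ t‖ with hdc
  set dv := ‖v₁ t - v₂ t‖ with hdv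
  have hdc0 : 0 ≤ dc := norm_nonneg _
  have hdv0 : 0 ≤ dv := norm_nonneg _
  have hGG : ‖G₁ t - G₂ t‖ ≤ Cg * C₀ * dc := by
    rw [mul_assoc]
    exact (hgl _ u₁ _ u₂).trans (mul_le_mul_of_nonneg_left hz hCg)
  have hsum : C₀ * dc ≤ (C₀ + 1) * (dc + dv) := by nlinarith [mul_nonneg hC₀ hdv0]
  have hsum' : dv ≤ (C₀ + 1) * (dc + dv) := by
    nlinarith [mul_nonneg hC₀ hdv0, mul_nonneg hC₀ hdc0]
  have hnn : ‖n₁ t - n₂ t‖ ≤ (C₀ + 1) * (dc + dv) :=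
    max_le (((norm_fst_le _).trans hz).trans hsum) hsum'
  have hzz : ‖(z₁ t, v₁ t) - (z₂ t, v₂ t)‖ ≤ (C₀ + 1) * (dc + dv) :=
    max_le (hz.trans hsum) hsum'
  have e1 : ‖nearForce q m (z₁ t, v₁ t) - nearForce q m (z₂ t, v₂ t)‖ ≤
      CΛ * ((C₀ + 1) * (dc + dv)) :=
    (hΛl _ u₅ _ u₆).trans (mul_le_mul_of_nonneg_left hzz hCΛ)
  have e2 : ‖(dopplerOp q m (n₁ t) - K₂ t) G₁'‖ ≤ CB * ((C₀ + 1) * (dc + dv)) * D₁ := by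
    refine (ContinuousLinearMap.le_opNorm _ _).trans ?_
    refine mul_le_mul ?_ hbG₁ (norm_nonneg _) (by positivity)
    exact (hBl _ u₃ _ u₄).trans (mul_le_mul_of_nonneg_left hnn hCB)
  have e3 : ‖K₂' (G₁ t - G₂ t)‖ ≤ D₂ * (Cg * C₀ * dc) :=
    (ContinuousLinearMap.le_opNorm _ _).trans (mul_le_mul hbK₂ hGG (norm_nonneg _) hD₂)
  have e4 : ‖K₂ t (G₁ t - G₂ t)‖ ≤ CK * (Cg * C₀ * dc) :=
    (ContinuousLinearMap.le_opNorm _ _).trans (mul_le_mul hbB.le hGG (norm_nonneg _) hCK0)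
  have p1 : 0 ≤ CΛ * (C₀ + 1) := by positivity
  have p2 : 0 ≤ CB * (C₀ + 1) * D₁ := by positivity
  have p3 : 0 ≤ D₂ * (Cg * C₀) := by positivity
  have p4 : 0 ≤ CK * (Cg * C₀) := by positivity
  refine ⟨hΔ.differentiableWithinAt.hasDerivWithinAt, ?_, ?_⟩
  · have hd : derivWithin (fun t => K₂ t (G₁ t - G₂ t)) S t =
        K₂' (G₁ t - G₂ t) + K₂ t (G₁' - G₂') := hΔ.derivWithin (hSu t htS)
    rw [hf₁, hf₂, hd]
    -- By the product rule the term `B(n₂) (G₁' - G₂')`, which has no Lipschitz bound, cancels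
    -- against `Δ'`. What remains contains `G₁'` only with the small factor `B(n₁) - B(n₂)`.
    have : nearForce q m (z₁ t, v₁ t) + dopplerOp q m (n₁ t) G₁' -
        (nearForce q m (z₂ t, v₂ t) + dopplerOp q m (n₂ t) G₂') -
        (K₂' (G₁ t - G₂ t) + K₂ t (G₁' - G₂')) =
        (nearForce q m (z₁ t, v₁ t) - nearForce q m (z₂ t, v₂ t)) +
          (dopplerOp q m (n₁ t) - K₂ t) G₁' - K₂' (G₁ t - G₂ t) := by
      rw [map_sub (K₂ t), sub_apply]
      simp only [hK₂]
      abel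
    refine (le_of_eq (congrArg norm this)).trans ?_
    refine (norm_sub_le _ _).trans ((add_le_add_left (norm_add_le _ _) _).trans ?_)
    nlinarith [mul_nonneg p4 hdc0, mul_nonneg p4 hdv0, mul_nonneg p3 hdv0]
  · nlinarith [mul_nonneg p1 hdc0, mul_nonneg p2 hdc0, mul_nonneg p3 hdc0]

end IsPath

/-! ### Trajectories, separation and initial domains -/

theorem Traj.norm_pos_sub_le {n : ℕ} (y z : Traj n) (j : Fin n) (t : ℝ) :
    ‖y.pos j t - z.pos j t‖ ≤ ‖y t - z t‖ :=
  (norm_fst_le (y t j - z t j)).trans (norm_le_pi_norm (y t - z t) j)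

theorem Traj.norm_vel_sub_le {n : ℕ} (y z : Traj n) (j : Fin n) (t : ℝ) :
    ‖y.vel j t - z.vel j t‖ ≤ ‖y t - z t‖ :=
  (norm_snd_le (y t j - z t j)).trans (norm_le_pi_norm (y t - z t) j)

theorem Traj.norm_sub_le_iff {n : ℕ} {y z : Traj n} {t t' B : ℝ} (hB : 0 ≤ B) :
    ‖y t - z t'‖ ≤ B ↔
      ∀ j, ‖y.pos j t - z.pos j t'‖ ≤ B ∧ ‖y.vel j t - z.vel j t'‖ ≤ B := by
  rw [pi_norm_le_iff_of_nonneg hB]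
  exact forall_congr' fun j => max_le_iff

namespace Traj

variable {n : ℕ} {x y z : Traj n} {s d : ℝ}

theorem pos_eqOn (h : EqOn y z (Iic d)) (j : Fin n) : EqOn (y.pos j) (z.pos j) (Iic d) :=
  fun t ht => by simp only [pos, h ht]

theorem vel_eqOn (h : EqOn y z (Iic d)) (j : Fin n) : EqOn (y.vel j) (z.vel j) (Iic d) :=
  fun t ht => by simp only [vel, h ht]

theorem eqOn_of_pos_vel (h : ∀ j, ∀ t ≤ d, y.pos j t = z.pos j t ∧ y.vel j t = z.vel j t) :
    EqOn y z (Iic d) :=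
  fun t ht => funext fun j => Prod.ext (h j t ht).1 (h j t ht).2

/-- The mean value inequality turns the speed bound into a Lipschitz bound for the positions. Taking
maxima with `0` makes the constants nonnegative even if there are no bodies. -/
theorem MemSpace.exists_isPath (hy : y.MemSpace d) :
    ∃ κ A : ℝ, 0 ≤ κ ∧ κ < 1 ∧ 0 ≤ A ∧ ∀ j, IsPath (y.pos j) (y.vel j) d κ A := by
  obtain ⟨hk, ⟨κ, hκ, hv⟩, A, hA⟩ := hy
  refine ⟨max κ 0, max A 0, le_max_right _ _, max_lt hκ one_pos, le_max_right _ _, fun j => ?_⟩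
  refine ⟨le_max_right _ _, max_lt hκ one_pos, fun t ht t' ht' => ?_, hk j, fun t ht t' ht' => ?_⟩
  · exact (convex_Iic d).norm_image_sub_le_of_norm_hasDerivWithin_le (fun t ht => hk j t ht)
      (fun t ht => (hv j t ht).trans (le_max_left _ _)) ht' ht
  · refine (hA j t ht t' ht').trans ?_
    gcongr
    exact le_max_left _ _

theorem memSpace_of_isPath {κ A : ℝ} (hκ : κ < 1)
    (h : ∀ j, IsPath (y.pos j) (y.vel j) d κ A) : y.MemSpace d :=
  ⟨fun j => (h j).hasDeriv, ⟨κ, hκ, fun j _ ht => (h j).norm_vel_le' ht⟩, A, fun j => (h j).vel_lip⟩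

theorem mem_initialDomain {κ A : ℝ} (he : EqOn y x (Iic s))
    (h : ∀ j, IsPath (y.pos j) (y.vel j) d κ A) : y ∈ x.initialDomain κ A s d :=
  ⟨he, fun j => (h j).hasDeriv, fun j => (h j).pos_lip, fun j => (h j).vel_lip⟩

theorem isPath_of_mem_initialDomain {κ A : ℝ} (h0 : 0 ≤ κ) (hκ : κ < 1)
    (hy : y ∈ x.initialDomain κ A s d) (j : Fin n) : IsPath (y.pos j) (y.vel j) d κ A :=
  ⟨h0, hκ, hy.2.2.1 j, hy.2.1 j, hy.2.2.2 j⟩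

theorem continuousOn_of_isPath {κ A : ℝ} (h : ∀ j, IsPath (y.pos j) (y.vel j) d κ A) :
    ContinuousOn y (Iic d) :=
  continuousOn_pi.2 fun j => (h j).continuousOn.prodMk (h j).continuousOn_vel

theorem MemSpace.mono (hy : y.MemSpace d) {d' : ℝ} (hd : d' ≤ d) : y.MemSpace d' := by
  obtain ⟨κ, A, -, hκ, -, h⟩ := hy.exists_isPath
  exact memSpace_of_isPath hκ fun j => (h j).mono hd

theorem MemSpace.congr (hy : y.MemSpace d) (he : EqOn z y (Iic d)) : z.MemSpace d := by
  obtain ⟨hk, ⟨κ, hκ, hv⟩, A, hA⟩ := hy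
  refine ⟨fun j t ht => ?_, ⟨κ, hκ, fun j t ht => ?_⟩, A, fun j t ht t' ht' => ?_⟩
  · rw [vel_eqOn he j ht]
    exact (hk j t ht).congr (fun t' ht' => pos_eqOn he j ht') (pos_eqOn he j ht)
  · rw [vel_eqOn he j ht]; exact hv j t ht
  · rw [vel_eqOn he j ht, vel_eqOn he j ht']; exact hA j t ht t' ht'

theorem sep_congr {t : ℝ} (h : y t = z t) : y.sep t = z.sep t := by
  simp only [sep, pos, h]

theorem pos_ne_of_sep_pos {t : ℝ} (h : 0 < y.sep t) {j k : Fin n} (hjk : j ≠ k) :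
    y.pos j t ≠ y.pos k t := by
  have h1 : y.sep t ≤ edist (y.pos j t) (y.pos k t) :=
    iInf_le_of_le j (iInf_le_of_le k (iInf_le _ hjk))
  exact edist_pos.1 (h.trans_le h1)

/-- There are finitely many pairs, so a vanishing infimum is attained. Pairs with `j = k` contribute
`⊤`, as does the empty system. -/
theorem sep_pos_iff {t : ℝ} : 0 < y.sep t ↔ ∀ j k, j ≠ k → y.pos j t ≠ y.pos k t := by
  refine ⟨fun h j k hjk => pos_ne_of_sep_pos h hjk, fun h => ?_⟩
  simp only [sep]
  refine pos_iff_ne_zero.2 fun h0 => ?_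
  rcases isEmpty_or_nonempty (Fin n) with he | he
  · rw [iInf_of_empty] at h0
    exact ENNReal.top_ne_zero h0
  · obtain ⟨j, hj⟩ := exists_eq_ciInf_of_finite
      (f := fun j => ⨅ (k : Fin n) (_ : j ≠ k), edist (y.pos j t) (y.pos k t))
    rw [h0] at hj
    obtain ⟨k, hk⟩ := exists_eq_ciInf_of_finite
      (f := fun k => ⨅ (_ : j ≠ k), edist (y.pos j t) (y.pos k t))
    rw [hj] at hk
    by_cases hjk : j = k
    · simp [hjk] at hk
    · simp [hjk] at hk
      exact h j k hjk hk

/-- All sufficiently short initial domains are regular. -/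
theorem eventually_isRegularDomain (hx : x.MemSpace s) (hs : 0 < x.sep s) {κ A : ℝ} (h0 : 0 ≤ κ)
    (hκ : κ < 1) (hA : 0 ≤ A) : ∀ᶠ e in 𝓝[>] s, x.IsRegularDomain κ A s e := by
  have h1 : Continuous fun e : ℝ => ENNReal.ofReal (3 * (1 + κ) * (e - s)) :=
    ENNReal.continuous_ofReal.comp (by fun_prop)
  have h2 : ∀ᶠ e in 𝓝 s, ENNReal.ofReal (3 * (1 + κ) * (e - s)) < x.sep s :=
    h1.continuousAt.eventually (gt_mem_nhds (by simpa using hs))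
  filter_upwards [nhdsWithin_le_nhds h2, self_mem_nhdsWithin] with e he he'
  exact ⟨hx, h0, hκ, hA, he', he⟩

end Traj

/-! ### Pointwise form of the Lipschitz condition on operators -/

section supNorm

variable {Y : Type*} [NormedAddCommGroup Y] {s d : ℝ} {f : ℝ → Y}

/-- Continuity is needed for boundedness: the real supremum of an unbounded family has the default
value `0`. -/
theorem norm_le_supNormOn (hf : ContinuousOn f (Icc s d)) {t : ℝ} (ht : t ∈ Icc s d) :
    ‖f t‖ ≤ supNormOn s d f := by
  have hb : BddAbove (range fun t : Icc s d => ‖f t‖) := by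
    have := (isCompact_Icc.image_of_continuousOn hf.norm).bddAbove
    rwa [image_eq_range] at this
  exact le_ciSup hb ⟨t, ht⟩

theorem supNormOn_le {B : ℝ} (hsd : s ≤ d) (h : ∀ t ∈ Icc s d, ‖f t‖ ≤ B) :
    supNormOn s d f ≤ B := by
  have : Nonempty (Icc s d) := ⟨⟨s, le_rfl, hsd⟩⟩
  exact ciSup_le fun t => h t t.2

end supNorm

/-- The Lipschitz property of a regular operator in terms of pointwise bounds. -/
theorem IsRegularNonanticipating.exists_bound {n : ℕ} {Y : Type*} [NormedAddCommGroup Y]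
    {P : Traj n → ℝ → Y} (hP : IsRegularNonanticipating P) {x : Traj n} {κ A s e : ℝ}
    (hx : x.IsRegularDomain κ A s e) :
    ∃ M, 0 ≤ M ∧ ∀ d ∈ Icc s e, ∀ y ∈ x.initialDomain κ A s d, ∀ z ∈ x.initialDomain κ A s d,
      ∀ B, (∀ t ∈ Icc s d, ‖y t - z t‖ ≤ B) → ∀ t ∈ Icc s d, ‖P y t - P z t‖ ≤ M * B := by
  obtain ⟨M, hM⟩ := hP.2 x κ A s e hx
  refine ⟨|M|, abs_nonneg M, fun d hd y hy z hz B hB t ht => ?_⟩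
  have hcont : ∀ u ∈ x.initialDomain κ A s d, ContinuousOn (P u) (Icc s d) := fun u hu =>
    (hP.1.1 d u (Traj.memSpace_of_isPath hx.2.2.1
      (Traj.isPath_of_mem_initialDomain hx.2.1 hx.2.2.1 hu))).mono Icc_subset_Iic_self
  refine (norm_le_supNormOn ((hcont y hy).sub (hcont z hz)) ht).trans ((hM d hd y hy z hz).trans ?_)
  have h0 : 0 ≤ supNormOn s d (fun t => y t - z t) := Real.iSup_nonneg fun _ => norm_nonneg _
  exact (mul_le_mul_of_nonneg_right (le_abs_self M) h0).trans
    (mul_le_mul_of_nonneg_left (supNormOn_le hd.1 hB) (abs_nonneg M))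

/-! ### Velocities as Lipschitz functions of momenta -/

/-- The velocity of a body with mass `m` and momentum `p`. -/
def velOfMomentum (m : ℝ) (p : E3) : E3 := (√(m ^ 2 + ‖p‖ ^ 2))⁻¹ • p

section momentum

variable {m : ℝ} (hm : 0 < m)
include hm

theorem differentiable_velOfMomentum : Differentiable ℝ (velOfMomentum m) := by
  have h : ∀ p : E3, m ^ 2 + ‖p‖ ^ 2 ≠ 0 := fun p => by positivity
  have h' : ∀ p : E3, √(m ^ 2 + ‖p‖ ^ 2) ≠ 0 := fun p => by positivity
  have h1 : Differentiable ℝ fun p : E3 => m ^ 2 + ‖p‖ ^ 2 :=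
    (differentiable_const _).add (differentiable_id.norm_sq ℝ)
  exact ((h1.sqrt h).inv h').smul differentiable_id

theorem velOfMomentum_momentum {v : E3} (hv : ‖v‖ < 1) :
    velOfMomentum m ((m * (√(1 - ‖v‖ ^ 2))⁻¹) • v) = v := by
  have h1 : 0 < 1 - ‖v‖ ^ 2 := by nlinarith [norm_nonneg v]
  have h2 : 0 < √(1 - ‖v‖ ^ 2) := Real.sqrt_pos.2 h1
  have h3 : m ^ 2 + ‖(m * (√(1 - ‖v‖ ^ 2))⁻¹) • v‖ ^ 2 = (m * (√(1 - ‖v‖ ^ 2))⁻¹) ^ 2 := by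
    rw [norm_smul, mul_pow, Real.norm_eq_abs, sq_abs, mul_pow, inv_pow, Real.sq_sqrt h1.le]
    field_simp
    ring
  rw [velOfMomentum, h3, Real.sqrt_sq (by positivity), smul_smul, inv_mul_cancel₀ (by positivity),
    one_smul]

theorem momentum_velOfMomentum (p : E3) :
    (m * (√(1 - ‖velOfMomentum m p‖ ^ 2))⁻¹) • velOfMomentum m p = p := by
  have h1 : 0 < m ^ 2 + ‖p‖ ^ 2 := by positivity
  have h2 : 0 < √(m ^ 2 + ‖p‖ ^ 2) := Real.sqrt_pos.2 h1
  have h3 : 1 - ‖velOfMomentum m p‖ ^ 2 = (m * (√(m ^ 2 + ‖p‖ ^ 2))⁻¹) ^ 2 := by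
    rw [velOfMomentum, norm_smul, mul_pow, Real.norm_eq_abs, sq_abs, mul_pow, inv_pow,
      Real.sq_sqrt h1.le]
    field_simp
    ring
  rw [h3, Real.sqrt_sq (by positivity), velOfMomentum, smul_smul]
  convert one_smul ℝ p using 2
  field_simp

/-- With `γ = √(m² + ‖p‖²)`, each of the two terms obtained by changing first the vector and then
the factor `γ⁻¹` is at most `‖p - p'‖ / m`: `γ` is at least `m`, dominates `‖p‖`, and is 1-Lipschitz
in `p`. -/
theorem norm_velOfMomentum_sub_le (p p' : E3) :
    ‖velOfMomentum m p - velOfMomentum m p'‖ ≤ 2 / m * ‖p - p'‖ := by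
  have key : ∀ p : E3, m ≤ √(m ^ 2 + ‖p‖ ^ 2) ∧ ‖p‖ ≤ √(m ^ 2 + ‖p‖ ^ 2) := fun p =>
    ⟨Real.le_sqrt_of_sq_le (by nlinarith [norm_nonneg p]),
      Real.le_sqrt_of_sq_le (by nlinarith [norm_nonneg p])⟩
  obtain ⟨h1, h2⟩ := key p
  obtain ⟨h1', h2'⟩ := key p'
  have hs := Real.sq_sqrt (show 0 ≤ m ^ 2 + ‖p‖ ^ 2 by positivity)
  have hs' := Real.sq_sqrt (show 0 ≤ m ^ 2 + ‖p'‖ ^ 2 by positivity)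
  simp only [velOfMomentum]
  set γ := √(m ^ 2 + ‖p‖ ^ 2) with hγ
  set γ' := √(m ^ 2 + ‖p'‖ ^ 2) with hγ'
  have hγ0 : 0 < γ := hm.trans_le h1
  have hγ0' : 0 < γ' := hm.trans_le h1'
  have h3 : |γ' - γ| ≤ ‖p - p'‖ := by
    have h4 : |‖p'‖ - ‖p‖| ≤ ‖p - p'‖ := by
      rw [abs_sub_comm]; exact abs_norm_sub_norm_le _ _
    have h5 : (γ' - γ) * (γ' + γ) = (‖p'‖ - ‖p‖) * (‖p'‖ + ‖p‖) := by nlinarith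
    have h6 : |γ' - γ| * (γ' + γ) ≤ ‖p - p'‖ * (γ' + γ) := by
      calc |γ' - γ| * (γ' + γ) = |(γ' - γ) * (γ' + γ)| := by
            rw [abs_mul, abs_of_pos (add_pos hγ0' hγ0)]
        _ = |‖p'‖ - ‖p‖| * (‖p'‖ + ‖p‖) := by
            rw [h5, abs_mul, abs_of_nonneg (add_nonneg (norm_nonneg p') (norm_nonneg p))]
        _ ≤ ‖p - p'‖ * (γ' + γ) := by gcongr
    exact le_of_mul_le_mul_right h6 (add_pos hγ0' hγ0)
  have h4 : γ⁻¹ • p - γ'⁻¹ • p' = γ⁻¹ • (p - p') + (γ⁻¹ * ((γ' - γ) * γ'⁻¹)) • p' := by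
    have : γ⁻¹ * ((γ' - γ) * γ'⁻¹) = γ⁻¹ - γ'⁻¹ := by field_simp
    rw [this, smul_sub, sub_smul]; abel
  have h5 : γ⁻¹ ≤ m⁻¹ := inv_anti₀ hm h1
  have h6 : γ'⁻¹ * ‖p'‖ ≤ 1 := by rw [inv_mul_le_iff₀ hγ0', mul_one]; exact h2'
  rw [h4]
  calc _ ≤ ‖γ⁻¹ • (p - p')‖ + ‖(γ⁻¹ * ((γ' - γ) * γ'⁻¹)) • p'‖ := norm_add_le _ _
    _ = γ⁻¹ * ‖p - p'‖ + γ⁻¹ * (|γ' - γ| * (γ'⁻¹ * ‖p'‖)) := by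
        rw [norm_smul, norm_smul, norm_mul, norm_mul, norm_inv, norm_inv, Real.norm_eq_abs,
          Real.norm_eq_abs, Real.norm_eq_abs, abs_of_pos hγ0, abs_of_pos hγ0']
        ring
    _ ≤ m⁻¹ * ‖p - p'‖ + m⁻¹ * (‖p - p'‖ * 1) := by gcongr
    _ = 2 / m * ‖p - p'‖ := by ring

end momentum

/-! ### Local uniqueness -/

open IsPath

namespace Traj

variable {n : ℕ}

/-- The force exerted by a body whose path is known up to time `a`. -/
theorem opH_eq_forceOp (m₀ q : Fin n → ℝ) {y x : Traj n} {a t κ A κ' A' : ℝ} {j k : Fin n} (hat : a ≤ t)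
    (hx : IsPath (x.pos k) (x.vel k) a κ A) (hy : IsPath (y.pos k) (y.vel k) t κ' A')
    (he : EqOn y x (Iic a)) (ht : t < a + ‖y.pos j t - x.pos k a‖) :
    y.opH m₀ q j k t (y.fieldOn j k t) =
      forceOp (q j) (m₀ k) (sepVec (x.pos k) a (y.pos j t) t, y.vel j t)
        (Field.newtonFeynman (x.pos k) a (y.pos j t) t) := by
  rw [forceOp_apply, opH, fieldOn, unitVec, hx.newtonFeynman_congr hy hat (pos_eqOn he k) ht,
    hx.e_congr hy hat (pos_eqOn he k) ht.le, hx.e_eq (hx.offPath_of_le hat ht)]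

/-- A signal emitted by body `k` at time `a` needs a positive time to reach body `j`, so for a while
`j` feels only the past of `k` before `a`. -/
theorem eventually_lt_arrival {y x : Traj n} {a b κ A : ℝ} {j k : Fin n} (hab : a < b)
    (hy : IsPath (y.pos j) (y.vel j) b κ A) (hne : y.pos j a ≠ x.pos k a) :
    ∀ᶠ t in 𝓝[Icc a b] a, t < a + ‖y.pos j t - x.pos k a‖ := by
  have h1 : ContinuousWithinAt (fun t => a + ‖y.pos j t - x.pos k a‖ - t) (Icc a b) a :=
    (continuousWithinAt_const.add
      (((hy.continuousOn a hab.le).mono Icc_subset_Iic_self).sub continuousWithinAt_const).norm).sub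
        continuousWithinAt_id
  have h2 : 0 < ‖y.pos j a - x.pos k a‖ := norm_pos_iff.2 (sub_ne_zero.2 hne)
  filter_upwards [h1.eventually (lt_mem_nhds (show 0 < a + ‖y.pos j a - x.pos k a‖ - a by linarith))]
    with t ht
  linarith

theorem vel_eq_velOfMomentum {m₀ : Fin n → ℝ} (hm₀ : ∀ j, 0 < m₀ j) {y : Traj n} {b κ A : ℝ}
    {j : Fin n} (hy : IsPath (y.pos j) (y.vel j) b κ A) {t : ℝ} (ht : t ≤ b) :
    y.vel j t = velOfMomentum (m₀ j) (y.momentum m₀ j t) :=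
  (velOfMomentum_momentum (hm₀ j) ((hy.norm_vel_le' ht).trans_lt hy.lt_one)).symm

end Traj

/-- The conditions of `IsSolution` on a compact interval `[a, b]`. -/
structure SolvesOn {n : ℕ} (m₀ q : Fin n → ℝ) (F₀ : Traj n → ℝ → Fin n → E3) (a b : ℝ)
    (y : Traj n) : Prop where
  memSpace : y.MemSpace b
  fieldExists : ∀ t ∈ Icc a b, ∀ j k, j ≠ k → y.FieldExists j k t
  equation : ∀ t ∈ Icc a b, ∀ j,
    HasDerivWithinAt (y.momentum m₀ j) (y.lorentzNewton m₀ q j t + F₀ y t j) (Icc a b) t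

theorem exists_Icc_of_eventually {a b : ℝ} {p : ℝ → Prop} (hab : a < b)
    (h : ∀ᶠ t in 𝓝[Icc a b] a, p t) : ∃ c ∈ Ioc a b, ∀ t ∈ Icc a c, p t := by
  rw [nhdsWithin_Icc_eq_nhdsGE hab] at h
  obtain ⟨c, hc, hs⟩ := mem_nhdsGE_iff_exists_Icc_subset.1 h
  refine ⟨min c b, ⟨lt_min hc hab, min_le_right _ _⟩, fun t ht => hs ⟨ht.1, ?_⟩⟩
  exact ht.2.trans (min_le_left _ _)

/-- Two solutions that agree up to some time agree for some further time, if the separation is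
positive. -/
theorem SolvesOn.exists_eqOn {n : ℕ} {m₀ q : Fin n → ℝ} (hm₀ : ∀ j, 0 < m₀ j)
    {F₀ : Traj n → ℝ → Fin n → E3} (hF₀ : IsRegularNonanticipating F₀) {a b : ℝ} (hab : a < b)
    {y z : Traj n} (hy : SolvesOn m₀ q F₀ a b y) (hz : SolvesOn m₀ q F₀ a b z)
    (he : EqOn z y (Iic a)) (hsep : 0 < y.sep a) : ∃ c ∈ Ioc a b, EqOn z y (Iic c) := by
  set S := Icc a b with hS
  have haS : a ∈ S := ⟨le_rfl, hab.le⟩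
  have hya : y.MemSpace a := hy.memSpace.mono hab.le
  -- common constants
  obtain ⟨κ₁, A₁, h01, hκ1, hA1, hy₁⟩ := hy.memSpace.exists_isPath
  obtain ⟨κ₂, A₂, h02, hκ2, hA2, hz₂⟩ := hz.memSpace.exists_isPath
  set κ := max κ₁ κ₂ with hκ
  set A := max A₁ A₂ with hA
  have hκlt : κ < 1 := max_lt hκ1 hκ2
  have hκ0 : 0 ≤ κ := h01.trans (le_max_left _ _)
  have hA0 : 0 ≤ A := hA1.trans (le_max_left _ _)
  have hyP : ∀ j, IsPath (y.pos j) (y.vel j) b κ A := fun j =>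
    (hy₁ j).mono_const (le_max_left _ _) hκlt (le_max_left _ _)
  have hzP : ∀ j, IsPath (z.pos j) (z.vel j) b κ A := fun j =>
    (hz₂ j).mono_const (le_max_right _ _) hκlt (le_max_right _ _)
  have hbase : ∀ k, IsPath (y.pos k) (y.vel k) a κ A := fun k => (hyP k).mono hab.le
  have hpa : ∀ j, z.pos j a = y.pos j a := fun j => Traj.pos_eqOn he j self_mem_Iic
  have hva : ∀ j, z.vel j a = y.vel j a := fun j => Traj.vel_eqOn he j self_mem_Iic
  -- fields in terms of the common past
  have hfield : ∀ u : Traj n, SolvesOn m₀ q F₀ a b u → (∀ j, IsPath (u.pos j) (u.vel j) b κ A) →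
      EqOn u y (Iic a) → ∀ j k, j ≠ k → ∀ᶠ t in 𝓝[S] a,
        Field.Exists (y.pos k) a (u.pos j t) t ∧
        u.opH m₀ q j k t (u.fieldOn j k t) =
          forceOp (q j) (m₀ k) (sepVec (y.pos k) a (u.pos j t) t, u.vel j t)
            (Field.newtonFeynman (y.pos k) a (u.pos j t) t) := by
    intro u hu huP hue j k hjk
    have hne : u.pos j a ≠ y.pos k a := by
      rw [Traj.pos_eqOn hue j self_mem_Iic]; exact Traj.pos_ne_of_sep_pos hsep hjk
    filter_upwards [Traj.eventually_lt_arrival hab (huP j) hne, self_mem_nhdsWithin] with t ht htS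
    have hut := (huP k).mono htS.2
    exact ⟨((hbase k).exists_congr hut htS.1 (Traj.pos_eqOn hue k) ht).1
      (hu.fieldExists t htS j k hjk),
      Traj.opH_eq_forceOp m₀ q htS.1 (hbase k) hut hue ht⟩
  -- The equation of motion makes velocities differentiable. The compensator needs this for one of
  -- the two solutions, since it differentiates an operator that contains the present velocity.
  have hvd : ∀ j, ∀ t ∈ S, DifferentiableWithinAt ℝ (y.vel j) S t := by
    intro j t ht
    have h1 := (differentiable_velOfMomentum (hm₀ j) (y.momentum m₀ j t)).comp_differentiableWithinAt
      t (hy.equation t ht j).differentiableWithinAt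
    exact h1.congr (fun t' ht' => Traj.vel_eq_velOfMomentum hm₀ (hyP j) ht'.2)
      (Traj.vel_eq_velOfMomentum hm₀ (hyP j) ht.2)
  have hcomp : ∀ j k, ∃ (C : ℝ) (Δ Δ' : ℝ → E3), 0 ≤ C ∧ Δ a = 0 ∧ (j ≠ k → ∀ᶠ t in 𝓝[S] a,
      HasDerivWithinAt Δ (Δ' t) S t ∧
      ‖z.opH m₀ q j k t (z.fieldOn j k t) - y.opH m₀ q j k t (y.fieldOn j k t) - Δ' t‖ ≤
        C * (‖z.pos j t - y.pos j t‖ + ‖z.vel j t - y.vel j t‖) ∧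
      ‖Δ t‖ ≤ C * ‖z.pos j t - y.pos j t‖) := by
    intro j k
    by_cases hjk : j = k
    · exact ⟨0, fun _ => 0, fun _ => 0, le_rfl, rfl, fun h => absurd hjk h⟩
    · have hz' := hfield z hz hzP he j k hjk
      have hy' := hfield y hy hyP (fun _ _ => rfl) j k hjk
      obtain ⟨C, Δ, Δ', hC, hΔ, hev⟩ := (hbase k).exists_compensator (q j) (m₀ k) hab (hzP j) (hyP j)
        (hpa j) (hva j) (Traj.pos_ne_of_sep_pos hsep hjk) (hvd j) (hz'.mono fun t h => h.1)
        (hy'.mono fun t h => h.1)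
      refine ⟨C, Δ, Δ', hC, hΔ, fun _ => ?_⟩
      filter_upwards [hev, hz', hy'] with t h1 h2 h3
      rw [h2.2, h3.2]
      exact h1
  choose C Δ Δ' hC hΔa hΔ using hcomp
  have hall : ∀ᶠ t in 𝓝[S] a, ∀ j k, j ≠ k →
      HasDerivWithinAt (Δ j k) (Δ' j k t) S t ∧
      ‖z.opH m₀ q j k t (z.fieldOn j k t) - y.opH m₀ q j k t (y.fieldOn j k t) - Δ' j k t‖ ≤
        C j k * (‖z.pos j t - y.pos j t‖ + ‖z.vel j t - y.vel j t‖) ∧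
      ‖Δ j k t‖ ≤ C j k * ‖z.pos j t - y.pos j t‖ := by
    rw [eventually_all]; intro j
    rw [eventually_all]; intro k
    by_cases hjk : j = k
    · exact Eventually.of_forall fun t h => absurd hjk h
    · exact (hΔ j k hjk).mono fun t h _ => h
  obtain ⟨c₁, hc₁, hc₁'⟩ := exists_Icc_of_eventually hab hall
  -- the external force
  obtain ⟨e, hreg, hae⟩ :=
    ((Traj.eventually_isRegularDomain hya hsep hκ0 hκlt hA0).and self_mem_nhdsWithin).exists
  obtain ⟨M, hM0, hM⟩ := hF₀.exists_bound hreg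
  -- the length of the interval
  set CC := ∑ j, ∑ k, C j k with hCC
  have hCC0 : 0 ≤ CC := Finset.sum_nonneg fun j _ => Finset.sum_nonneg fun k _ => hC j k
  set L := ∑ j, 2 / m₀ j with hL
  have hL0 : 0 ≤ L := Finset.sum_nonneg fun j _ => by have := hm₀ j; positivity
  -- The `1` accounts for the positions and `L` converts momenta into velocities. Of the `3 * CC`,
  -- two come from the residual force (positions and velocities) and one from the compensator. A
  -- length of at most `1 / (2 * B)` gives the factor `1 / 2`.
  set B := 1 + L * (3 * CC + M) with hB
  have hB0 : 0 < B := by positivity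
  set c := min (min c₁ e) (a + 1 / (2 * B)) with hc
  have hac : a < c := lt_min (lt_min hc₁.1 hae) (by have : 0 < 1 / (2 * B) := by positivity
                                                    linarith)
  have hcc₁ : c ≤ c₁ := (min_le_left _ _).trans (min_le_left _ _)
  have hcb : c ≤ b := hcc₁.trans hc₁.2
  have hce : c ≤ e := (min_le_left _ _).trans (min_le_right _ _)
  have hcB : B * (c - a) ≤ 1 / 2 := by
    have : c ≤ a + 1 / (2 * B) := min_le_right _ _
    have h1 : B * (c - a) ≤ B * (1 / (2 * B)) := by gcongr; linarith
    refine h1.trans (le_of_eq ?_)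
    field_simp
  refine ⟨c, ⟨hac, hcb⟩, ?_⟩
  have hsub : Icc a c ⊆ S := Icc_subset_Icc_right hcb
  have hcy : ContinuousOn (fun t => z t - y t) (Icc a c) :=
    ((Traj.continuousOn_of_isPath hzP).sub (Traj.continuousOn_of_isPath hyP)).mono
      fun t ht => ht.2.trans hcb
  set σ := supNormOn a c (fun t => z t - y t) with hσ
  have hσle : ∀ t ∈ Icc a c, ‖z t - y t‖ ≤ σ := fun t ht => norm_le_supNormOn hcy ht
  have hσ0 : 0 ≤ σ := (norm_nonneg _).trans (hσle a ⟨le_rfl, hac.le⟩)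
  have hF : ∀ t ∈ Icc a c, ‖F₀ z t - F₀ y t‖ ≤ M * σ :=
    hM c ⟨hac.le, hce⟩ z (Traj.mem_initialDomain he fun j => (hzP j).mono hcb) y
      (Traj.mem_initialDomain (fun _ _ => rfl) fun j => (hyP j).mono hcb) σ hσle
  -- Positions gain a factor `c - a` over velocities. Hence the compensator, which is bounded by
  -- positions alone, is small although it is not integrated.
  have hpos : ∀ t ∈ Icc a c, ∀ j, ‖z.pos j t - y.pos j t‖ ≤ σ * (c - a) := by
    intro t ht j
    have h1 : ∀ t ∈ Icc a c, HasDerivWithinAt (fun t => z.pos j t - y.pos j t)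
        (z.vel j t - y.vel j t) (Icc a c) t := fun t ht =>
      (((hzP j).hasDeriv t (ht.2.trans hcb)).sub ((hyP j).hasDeriv t (ht.2.trans hcb))).mono
        fun t' ht' => ht'.2.trans hcb
    have h2 := (convex_Icc a c).norm_image_sub_le_of_norm_hasDerivWithin_le h1
      (fun t ht => (Traj.norm_vel_sub_le z y j t).trans (hσle t ht)) ⟨le_rfl, hac.le⟩ ht
    simp only [hpa, sub_self, sub_zero] at h2
    refine h2.trans ?_
    rw [Real.norm_eq_abs, abs_of_nonneg (by linarith [ht.1])]
    gcongr
    exact ht.2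
  have hmom : ∀ t ∈ Icc a c, ∀ j,
      ‖z.momentum m₀ j t - y.momentum m₀ j t‖ ≤ (3 * CC + M) * σ * (c - a) := by
    intro t ht j
    set K := Finset.univ.filter (fun k : Fin n => k ≠ j) with hK
    have hCj : ∑ k ∈ K, C j k ≤ CC := by
      refine (Finset.sum_le_sum_of_subset_of_nonneg (Finset.filter_subset _ _)
        fun k _ _ => hC j k).trans ?_
      exact Finset.single_le_sum (f := fun j => ∑ k, C j k)
        (fun j _ => Finset.sum_nonneg fun k _ => hC j k) (Finset.mem_univ j)
    -- Without the compensators the derivative of the momentum difference could not be bounded by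
    -- `σ`.
    set W : ℝ → E3 := fun t => z.momentum m₀ j t - y.momentum m₀ j t - ∑ k ∈ K, Δ j k t with hW
    have h1 : ∀ t ∈ Icc a c, HasDerivWithinAt W
        (z.lorentzNewton m₀ q j t + F₀ z t j - (y.lorentzNewton m₀ q j t + F₀ y t j) -
          ∑ k ∈ K, Δ' j k t) (Icc a c) t := by
      intro t ht
      have hd : HasDerivWithinAt (fun t => ∑ k ∈ K, Δ j k t) (∑ k ∈ K, Δ' j k t) S t :=
        HasDerivWithinAt.fun_sum fun k hk =>
          (hc₁' t ⟨ht.1, ht.2.trans hcc₁⟩ j k (Finset.mem_filter.1 hk).2.symm).1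
      exact (((hz.equation t (hsub ht) j).sub (hy.equation t (hsub ht) j)).sub hd).mono hsub
    have h2 : ∀ t ∈ Icc a c, ‖z.lorentzNewton m₀ q j t + F₀ z t j -
        (y.lorentzNewton m₀ q j t + F₀ y t j) - ∑ k ∈ K, Δ' j k t‖ ≤ (2 * CC + M) * σ := by
      intro t ht
      have h3 : z.lorentzNewton m₀ q j t + F₀ z t j - (y.lorentzNewton m₀ q j t + F₀ y t j) -
          ∑ k ∈ K, Δ' j k t = (∑ k ∈ K, (z.opH m₀ q j k t (z.fieldOn j k t) -
            y.opH m₀ q j k t (y.fieldOn j k t) - Δ' j k t)) + (F₀ z t - F₀ y t) j := by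
        rw [Finset.sum_sub_distrib, Finset.sum_sub_distrib]
        simp only [Traj.lorentzNewton, Pi.sub_apply, hK]
        abel
      rw [h3]
      have h4 : ∑ k ∈ K, ‖z.opH m₀ q j k t (z.fieldOn j k t) -
            y.opH m₀ q j k t (y.fieldOn j k t) - Δ' j k t‖ ≤ ∑ k ∈ K, C j k * (2 * σ) := by
        refine Finset.sum_le_sum fun k hk => ?_
        refine ((hc₁' t ⟨ht.1, ht.2.trans hcc₁⟩ j k (Finset.mem_filter.1 hk).2.symm).2.1).trans ?_
        refine mul_le_mul_of_nonneg_left ?_ (hC j k)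
        linarith [(Traj.norm_pos_sub_le z y j t).trans (hσle t ht),
          (Traj.norm_vel_sub_le z y j t).trans (hσle t ht)]
      rw [← Finset.sum_mul] at h4
      have h5 := mul_le_mul_of_nonneg_right hCj (show 0 ≤ 2 * σ by positivity)
      have h6 : ‖(F₀ z t - F₀ y t) j‖ ≤ M * σ := (norm_le_pi_norm _ j).trans (hF t ht)
      refine (norm_add_le _ _).trans ?_
      linarith [norm_sum_le K fun k => z.opH m₀ q j k t (z.fieldOn j k t) -
            y.opH m₀ q j k t (y.fieldOn j k t) - Δ' j k t]
    have h3 := (convex_Icc a c).norm_image_sub_le_of_norm_hasDerivWithin_le h1 h2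
      ⟨le_rfl, hac.le⟩ ht
    have hWa : W a = 0 := by
      simp only [hW, hΔa, Finset.sum_const_zero, Traj.momentum, hva, sub_self]
    rw [hWa, sub_zero, Real.norm_eq_abs, abs_of_nonneg (by linarith [ht.1])] at h3
    have h3' : (2 * CC + M) * σ * (t - a) ≤ (2 * CC + M) * σ * (c - a) := by
      gcongr
      exact ht.2
    have h4 : ‖∑ k ∈ K, Δ j k t‖ ≤ CC * (σ * (c - a)) := by
      have h5 : ∀ k ∈ K, ‖Δ j k t‖ ≤ C j k * (σ * (c - a)) := fun k hk =>
        ((hc₁' t ⟨ht.1, ht.2.trans hcc₁⟩ j k (Finset.mem_filter.1 hk).2.symm).2.2).trans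
          (mul_le_mul_of_nonneg_left (hpos t ht j) (hC j k))
      refine (norm_sum_le_of_le K h5).trans ?_
      rw [← Finset.sum_mul]
      exact mul_le_mul_of_nonneg_right hCj (mul_nonneg hσ0 (by linarith))
    have h5 : z.momentum m₀ j t - y.momentum m₀ j t = W t + ∑ k ∈ K, Δ j k t := by
      simp only [hW]; abel
    rw [h5]
    refine (norm_add_le _ _).trans ?_
    linarith
  have hhalf : ∀ t ∈ Icc a c, ‖z t - y t‖ ≤ 1 / 2 * σ := by
    intro t ht
    rw [Traj.norm_sub_le_iff (by positivity)]
    intro j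
    have hca : 0 ≤ c - a := by linarith
    have hBσ : B * (c - a) * σ ≤ 1 / 2 * σ := mul_le_mul_of_nonneg_right hcB hσ0
    constructor
    · refine (hpos t ht j).trans (le_trans ?_ hBσ)
      have : 0 ≤ L * (3 * CC + M) * (c - a) * σ := by positivity
      rw [hB]; linarith
    · have hLj : 2 / m₀ j ≤ L := Finset.single_le_sum (f := fun j => 2 / m₀ j)
        (fun j _ => by have := hm₀ j; positivity) (Finset.mem_univ j)
      rw [Traj.vel_eq_velOfMomentum hm₀ (hzP j) (ht.2.trans hcb),
        Traj.vel_eq_velOfMomentum hm₀ (hyP j) (ht.2.trans hcb)]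
      refine (norm_velOfMomentum_sub_le (hm₀ j) _ _).trans ?_
      refine (mul_le_mul hLj (hmom t ht j) (norm_nonneg _) hL0).trans (le_trans ?_ hBσ)
      have : 0 ≤ (c - a) * σ := by positivity
      rw [hB]; linarith
  have hσhalf : σ ≤ 1 / 2 * σ := supNormOn_le hac.le hhalf
  intro t ht
  rcases le_total t a with hta | hat
  · exact he hta
  · have := hσle t ⟨hat, ht⟩
    have h0 : ‖z t - y t‖ ≤ 0 := by linarith
    exact sub_eq_zero.1 (norm_le_zero_iff.1 h0)

/-! ### Regularity of the field of a `C³` path -/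

/-- The partial derivative with respect to time. -/
def timeDeriv (F : E3 × ℝ → E3) (z : E3 × ℝ) : E3 := fderiv ℝ F z (0, 1)

theorem hasDerivAt_timeDeriv {F : E3 × ℝ → E3} {r : E3} {t : ℝ}
    (hF : DifferentiableAt ℝ F (r, t)) :
    HasDerivAt (fun t' => F (r, t')) (timeDeriv F (r, t)) t :=
  HasFDerivAt.comp_hasDerivAt t hF.hasFDerivAt
    ((hasDerivAt_const t r).prodMk (hasDerivAt_id t))

theorem contDiffAt_timeDeriv {F : E3 × ℝ → E3} {z : E3 × ℝ} {m n : WithTop ℕ∞}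
    (hF : ContDiffAt ℝ n F z) (hmn : m + 1 ≤ n) : ContDiffAt ℝ m (timeDeriv F) z :=
  (hF.fderiv_right hmn).clm_apply contDiffAt_const

namespace IsPath

variable {ρ w : ℝ → E3} {a κ A : ℝ} (h : IsPath ρ w a κ A) {r : E3} {t : ℝ}
  (ht : OffPath ρ a r t)
include h ht

theorem contDiffAt_sepVec {n : WithTop ℕ∞} (hn : n ≠ 0) (hρ : ∀ σ < a, ContDiffAt ℝ n ρ σ) :
    ContDiffAt ℝ n (fun z : E3 × ℝ => sepVec ρ a z.1 z.2) (r, t) := by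
  have hτ := hρ _ (h.tau_lt ht.1)
  exact contDiffAt_fst.sub (ContDiffAt.comp (r, t)
    (f := fun z : E3 × ℝ => Field.tau ρ a z.1 z.2) hτ (h.contDiffAt_tau ht hn hτ))

variable (hρ : ∀ σ < a, ContDiffAt ℝ 3 ρ σ)
include hρ

theorem contDiffAt_e : ContDiffAt ℝ 3 (fun z : E3 × ℝ => Field.e ρ a z.1 z.2) (r, t) := by
  refine (ContDiffAt.comp (r, t) (contDiffAt_unitDir (h.sepVec_ne ht))
    (h.contDiffAt_sepVec ht (by norm_num) hρ)).congr_of_eventuallyEq ?_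
  filter_upwards [h.eventually_offPath ht] with z hz using h.e_eq hz

theorem contDiffAt_coulombField :
    ContDiffAt ℝ 3 (fun z : E3 × ℝ => Field.u ρ a z.1 z.2 ^ 2 • Field.e ρ a z.1 z.2) (r, t) := by
  refine (ContDiffAt.comp (r, t) (contDiffAt_coulomb (h.sepVec_ne ht))
    (h.contDiffAt_sepVec ht (by norm_num) hρ)).congr_of_eventuallyEq ?_
  filter_upwards [h.eventually_offPath ht] with z hz
  rw [h.e_eq hz, h.u_eq hz]; rfl

theorem deriv_e_eventuallyEq_timeDeriv :
    (deriv fun t' => Field.e ρ a r t') =ᶠ[𝓝 t]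
      fun t' => timeDeriv (fun z : E3 × ℝ => Field.e ρ a z.1 z.2) (r, t') := by
  filter_upwards [h.eventually_offPath_time ht] with t' ht'
  exact (hasDerivAt_timeDeriv ((h.contDiffAt_e ht' hρ).differentiableAt (by norm_num))).deriv

theorem hasDerivAt_deriv_e :
    HasDerivAt (deriv fun t' => Field.e ρ a r t')
      (timeDeriv (timeDeriv fun z : E3 × ℝ => Field.e ρ a z.1 z.2) (r, t)) t :=
  (hasDerivAt_timeDeriv ((contDiffAt_timeDeriv (m := 2) (h.contDiffAt_e ht hρ)
    (by norm_num)).differentiableAt two_ne_zero)).congr_of_eventuallyEq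
      (h.deriv_e_eventuallyEq_timeDeriv ht hρ)

theorem exists_of_contDiffAt : Field.Exists ρ a r t := by
  refine ⟨(h.hasDerivAt_coulomb ht).differentiableAt, ?_,
    (h.hasDerivAt_deriv_e ht hρ).differentiableAt⟩
  filter_upwards [h.eventually_offPath_time ht] with t' ht' using
    (h.hasDerivAt_e ht').differentiableAt

/-- `e` and `u² e` are `C³` functions of the point, and at most two time derivatives are taken.
Three derivatives of the path thus leave a field that is locally Lipschitz in space and time. -/
theorem contDiffAt_newtonFeynman :
    ContDiffAt ℝ 1 (fun z : E3 × ℝ => Field.newtonFeynman ρ a z.1 z.2) (r, t) := by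
  have h1 := h.contDiffAt_coulombField ht hρ
  have h2 := contDiffAt_timeDeriv (m := 1) h1 (by norm_num)
  have h3 := contDiffAt_timeDeriv (m := 2) (h.contDiffAt_e ht hρ) (by norm_num)
  have h4 := contDiffAt_timeDeriv (m := 1) h3 (by norm_num)
  have h5 : ContDiffAt ℝ 1 (fun z : E3 × ℝ => ‖sepVec ρ a z.1 z.2‖) (r, t) :=
    ((h.contDiffAt_sepVec ht (by norm_num) hρ).of_le (by norm_num)).norm ℝ (h.sepVec_ne ht)
  refine (((h1.of_le (by norm_num)).add (h5.smul h2)).add h4).congr_of_eventuallyEq ?_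
  filter_upwards [h.eventually_offPath ht] with z hz
  have h6 := (hasDerivAt_timeDeriv
    ((h.contDiffAt_coulombField hz hρ).differentiableAt (by norm_num))).deriv
  rw [Field.newtonFeynman, (h.hasDerivAt_deriv_e hz hρ).deriv, h.u_eq hz, inv_inv,
    ← h.u_eq hz]
  rw [h6]
  rfl

end IsPath

/-! ### Trajectories with prescribed velocities -/

theorem exists_primitive {f : ℝ → E3} {s b : ℝ} (hsb : s ≤ b) (hf : ContinuousOn f (Icc s b))
    (p₀ : E3) : ∃ p : ℝ → E3, p s = p₀ ∧ ∀ t ∈ Icc s b, HasDerivWithinAt p (f t) (Icc s b) t := by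
  have hc : Continuous (IccExtend hsb ((Icc s b).domRestrict f)) :=
    (continuousOn_iff_continuous_domRestrict.1 hf).Icc_extend'
  refine ⟨fun t => p₀ + ∫ u in s..t, IccExtend hsb ((Icc s b).domRestrict f) u, by simp,
    fun t ht => ?_⟩
  have h1 := (hc.integral_hasStrictDerivAt s t).hasDerivAt.const_add p₀
  rw [IccExtend_of_mem _ _ ht] at h1
  exact h1.hasDerivWithinAt

namespace Traj

variable {n : ℕ}

/-- The trajectory with velocities `U` that agrees with `x` at time `s`. -/
def ofVel (x : Traj n) (s : ℝ) (U : ℝ → Fin n → E3) : Traj n :=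
  fun t j => (x.pos j s + ∫ τ in s..t, U τ j, U t j)

section ofVel

variable {x : Traj n} {s κ₀ A₀ κ A : ℝ} {U : ℝ → Fin n → E3}
  (hx : ∀ j, IsPath (x.pos j) (x.vel j) s κ₀ A₀) (h0 : 0 ≤ κ) (h1 : κ < 1)
  (hU : ∀ j t t', ‖U t j - U t' j‖ ≤ A * |t - t'|) (hUκ : ∀ j t, ‖U t j‖ ≤ κ)

include hU in
theorem continuous_of_lip (j : Fin n) : Continuous fun t => U t j := by
  have : LipschitzWith (Real.toNNReal |A|) fun t => U t j := by
    refine LipschitzWith.of_dist_le_mul fun t t' => ?_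
    rw [dist_eq_norm, Real.dist_eq, Real.coe_toNNReal _ (abs_nonneg A)]
    exact (hU j t t').trans (mul_le_mul_of_nonneg_right (le_abs_self A) (abs_nonneg _))
  exact this.continuous

include hU in
theorem hasDerivAt_ofVel (j : Fin n) (t : ℝ) :
    HasDerivAt ((x.ofVel s U).pos j) ((x.ofVel s U).vel j t) t :=
  ((continuous_of_lip hU j).integral_hasStrictDerivAt s t).hasDerivAt.const_add _

include h0 h1 hU hUκ in
theorem isPath_ofVel (d : ℝ) (j : Fin n) :
    IsPath ((x.ofVel s U).pos j) ((x.ofVel s U).vel j) d κ A where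
  nonneg := h0
  lt_one := h1
  pos_lip t _ t' _ := convex_univ.norm_image_sub_le_of_norm_hasDerivWithin_le
    (fun t _ => (hasDerivAt_ofVel hU j t).hasDerivWithinAt) (fun t _ => hUκ j t)
    (mem_univ t') (mem_univ t)
  hasDeriv t _ := (hasDerivAt_ofVel hU j t).hasDerivWithinAt
  vel_lip t _ t' _ := hU j t t'

include hx hU in
theorem ofVel_eqOn (hUx : ∀ j, ∀ t ≤ s, U t j = x.vel j t) : EqOn (x.ofVel s U) x (Iic s) := by
  refine eqOn_of_pos_vel fun j t ht => ⟨?_, hUx j t ht⟩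
  have hd : ∀ t ∈ Iic s, HasDerivWithinAt (fun t => (x.ofVel s U).pos j t - x.pos j t) 0
      (Iic s) t := fun t ht => by
    have := (hasDerivAt_ofVel (x := x) (s := s) hU j t).hasDerivWithinAt.sub ((hx j).hasDeriv t ht)
    rwa [show (x.ofVel s U).vel j t = x.vel j t from hUx j t ht, sub_self] at this
  have h2 := (convex_Iic s).norm_image_sub_le_of_norm_hasDerivWithin_le hd
    (fun _ _ => norm_zero.le) (self_mem_Iic) ht
  have h3 : (x.ofVel s U).pos j s = x.pos j s := by simp [ofVel, pos]
  rw [h3, sub_self, sub_zero, zero_mul] at h2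
  exact sub_eq_zero.1 (norm_le_zero_iff.1 h2)

end ofVel

/-- Velocities on `[s, b]`, continued by those of `x` before `s` and by constants after `b`. -/
def extendVel (x : Traj n) {s b : ℝ} (hsb : s ≤ b) (V : Icc s b → Fin n → E3) :
    ℝ → Fin n → E3 :=
  fun t => if t ≤ s then fun j => x.vel j t else V (projIcc s b hsb t)

section extendVel

variable {x : Traj n} {s b κ₀ A₀ A : ℝ} {hsb : s ≤ b} {V : Icc s b → Fin n → E3}

theorem extendVel_of_le {t : ℝ} (ht : t ≤ s) : x.extendVel hsb V t = fun j => x.vel j t :=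
  if_pos ht

theorem extendVel_of_ge (hVs : ∀ j, V ⟨s, le_rfl, hsb⟩ j = x.vel j s) {t : ℝ} (ht : s ≤ t) :
    x.extendVel hsb V t = V (projIcc s b hsb t) := by
  rcases ht.eq_or_lt with rfl | ht
  · rw [extendVel_of_le le_rfl, projIcc_left]; exact funext fun j => (hVs j).symm
  · exact if_neg ht.not_ge

theorem extendVel_lip (hx : ∀ j, IsPath (x.pos j) (x.vel j) s κ₀ A₀) (hA : A₀ ≤ A)
    (hA0 : 0 ≤ A) (hVs : ∀ j, V ⟨s, le_rfl, hsb⟩ j = x.vel j s)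
    (hV : ∀ j t t', ‖V t j - V t' j‖ ≤ A * |(t : ℝ) - t'|) (j : Fin n) (t t' : ℝ) :
    ‖x.extendVel hsb V t j - x.extendVel hsb V t' j‖ ≤ A * |t - t'| := by
  have hle : ∀ t t', t ≤ s → t' ≤ s →
      ‖x.extendVel hsb V t j - x.extendVel hsb V t' j‖ ≤ A * |t - t'| := by
    intro t t' ht ht'
    rw [extendVel_of_le ht, extendVel_of_le ht']
    exact ((hx j).vel_lip t ht t' ht').trans (mul_le_mul_of_nonneg_right hA (abs_nonneg _))
  have hge : ∀ t t', s ≤ t → s ≤ t' →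
      ‖x.extendVel hsb V t j - x.extendVel hsb V t' j‖ ≤ A * |t - t'| := by
    intro t t' ht ht'
    rw [extendVel_of_ge hVs ht, extendVel_of_ge hVs ht']
    exact (hV j _ _).trans (mul_le_mul_of_nonneg_left (abs_projIcc_sub_projIcc hsb) hA0)
  have hmix : ∀ t t', t ≤ s → s ≤ t' →
      ‖x.extendVel hsb V t j - x.extendVel hsb V t' j‖ ≤ A * |t - t'| := by
    intro t t' ht ht'
    have h1 := hle t s ht le_rfl
    have h2 := hge s t' le_rfl ht'
    refine (norm_sub_le_norm_sub_add_norm_sub _ (x.extendVel hsb V s j) _).trans ?_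
    rw [abs_of_nonpos (by linarith)] at h1 h2 ⊢
    linarith
  rcases le_total t s with ht | ht <;> rcases le_total t' s with ht' | ht'
  · exact hle t t' ht ht'
  · exact hmix t t' ht ht'
  · rw [norm_sub_rev, abs_sub_comm]; exact hmix t' t ht' ht
  · exact hge t t' ht ht'

end extendVel

end Traj

/-! ### Local existence by a contraction in the space of velocities -/

theorem eventually_mul_sub_lt (R s : ℝ) {r : ℝ} (hr : 0 < r) :
    ∀ᶠ b in 𝓝[>] s, R * (b - s) < r := by
  have h1 : Continuous fun b : ℝ => R * (b - s) := by fun_prop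
  exact nhdsWithin_le_nhds (h1.continuousAt.eventually (gt_mem_nhds (by simpa using hr)))

namespace Traj

variable {n : ℕ}

/-- The velocities on `[s, b]` that continue those of `x` and have the Lipschitz constant `A`. -/
def velSpace (x : Traj n) {s b : ℝ} (hsb : s ≤ b) (A : ℝ) : Set C(Icc s b, Fin n → E3) :=
  {V | (∀ j, V ⟨s, le_rfl, hsb⟩ j = x.vel j s) ∧
    ∀ j t t', ‖V t j - V t' j‖ ≤ A * |(t : ℝ) - t'|}

theorem isClosed_velSpace (x : Traj n) {s b : ℝ} (hsb : s ≤ b) (A : ℝ) :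
    IsClosed (x.velSpace hsb A) := by
  have hc : ∀ (t : Icc s b) (j : Fin n), Continuous fun V : C(Icc s b, Fin n → E3) => V t j :=
    fun t j => (continuous_apply j).comp (continuous_eval_const t)
  have : x.velSpace hsb A = (⋂ j, {V | V ⟨s, le_rfl, hsb⟩ j = x.vel j s}) ∩
      ⋂ j, ⋂ t : Icc s b, ⋂ t' : Icc s b, {V | ‖V t j - V t' j‖ ≤ A * |(t : ℝ) - t'|} := by
    ext V; simp only [velSpace, mem_inter_iff, mem_iInter, mem_ofPred_eq]
  rw [this]
  refine (isClosed_iInter fun j => isClosed_eq (hc _ j) continuous_const).inter ?_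
  exact isClosed_iInter fun j => isClosed_iInter fun t => isClosed_iInter fun t' =>
    isClosed_le ((hc t j).sub (hc t' j)).norm continuous_const

/-- Local existence for the relativistic equations of motion with a smooth local force and a regular
nonanticipating force. -/
theorem exists_local_solution {m₀ : Fin n → ℝ} (hm₀ : ∀ j, 0 < m₀ j)
    {F₀ : Traj n → ℝ → Fin n → E3} (hF₀ : IsRegularNonanticipating F₀) {s : ℝ} {x : Traj n}
    (hx : x.MemSpace s) (hsep : 0 < x.sep s) {Φ : Fin n → (E3 × E3) × ℝ → E3}
    (hΦ : ∀ j, ContDiffAt ℝ 1 (Φ j) ((x.pos j s, x.vel j s), s)) {b₀ : ℝ} (hb₀ : s < b₀) :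
    ∃ b ∈ Ioc s b₀, ∃ y : Traj n, EqOn y x (Iic s) ∧ y.MemSpace b ∧
      ∀ t ∈ Icc s b, ∀ j, HasDerivWithinAt (y.momentum m₀ j)
        (Φ j ((y.pos j t, y.vel j t), t) + F₀ y t j) (Icc s b) t := by
  obtain ⟨κ₀, A₀, hκ₀, hκ₀1, hA₀, hxP⟩ := hx.exists_isPath
  -- The midpoint between `κ₀` and `1` leaves room for the speeds to grow after `s`.
  set κ := (1 + κ₀) / 2 with hκ
  have hκlt : κ < 1 := by linarith
  have hκκ₀ : κ₀ < κ := by linarith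
  have hκ0 : 0 ≤ κ := by linarith
  -- the local force
  choose CΦ hCΦ UΦ hUΦ hΦl using fun j => (hΦ j).exists_norm_sub_le
  have hδ : ∃ δ > 0, ∀ j, Metric.ball (((x.pos j s, x.vel j s), s) : (E3 × E3) × ℝ) δ ⊆ UΦ j := by
    choose δ hδ hδ' using fun j => Metric.mem_nhds_iff.1 (hUΦ j)
    rcases isEmpty_or_nonempty (Fin n) with he | he
    · exact ⟨1, one_pos, fun j => he.elim j⟩
    · obtain ⟨j₀, hj₀⟩ := Finite.exists_min δ
      exact ⟨δ j₀, hδ j₀, fun j => (Metric.ball_subset_ball (hj₀ j)).trans (hδ' j)⟩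
  obtain ⟨δ, hδ0, hδ⟩ := hδ
  set C := ∑ j, CΦ j with hC
  have hC0 : 0 ≤ C := Finset.sum_nonneg fun j _ => hCΦ j
  have hCj : ∀ j, CΦ j ≤ C := fun j =>
    Finset.single_le_sum (f := CΦ) (fun j _ => hCΦ j) (Finset.mem_univ j)
  set BΦ := ∑ j, ‖Φ j ((x.pos j s, x.vel j s), s)‖ + C * δ with hBΦ
  have hBΦ0 : 0 ≤ BΦ := by positivity
  -- the reference trajectory
  set xr : Traj n := x.ofVel s (fun t j => x.vel j (min t s)) with hxr
  have hUr : ∀ j t t', ‖x.vel j (min t s) - x.vel j (min t' s)‖ ≤ A₀ * |t - t'| := fun j t t' =>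
    ((hxP j).vel_lip _ (min_le_right _ _) _ (min_le_right _ _)).trans
      (mul_le_mul_of_nonneg_left
        ((abs_min_sub_min_le_max t s t' s).trans (by simp)) hA₀)
  have hUrκ : ∀ j t, ‖x.vel j (min t s)‖ ≤ κ₀ := fun j t => (hxP j).norm_vel_le' (min_le_right _ _)
  have hxrP := isPath_ofVel (x := x) (s := s) hκ₀ hκ₀1 hUr hUrκ
  have hxrx : EqOn xr x (Iic s) := ofVel_eqOn hxP hUr fun j t ht => by
    simp only [min_eq_left ht]
  set C₀ := ‖F₀ xr s‖ + 1 with hC₀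
  have hC₀0 : 0 ≤ C₀ := by positivity
  have hF₀xr : ∀ᶠ b in 𝓝[>] s, ∀ t ∈ Icc s b, ‖F₀ xr t‖ ≤ C₀ := by
    have h1 : ContinuousAt (F₀ xr) s :=
      (hF₀.1.1 (s + 1) xr (memSpace_of_isPath hκ₀1 (hxrP (s + 1)))).continuousAt
        (Iic_mem_nhds (lt_add_one s))
    have h2 : ∀ᶠ t in 𝓝 s, ‖F₀ xr t‖ < C₀ := h1.norm.eventually (gt_mem_nhds (lt_add_one _))
    obtain ⟨c, hc, hs⟩ := mem_nhdsGE_iff_exists_Icc_subset.1 (mem_nhdsWithin_of_mem_nhds h2)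
    filter_upwards [Ioc_mem_nhdsGT hc] with b hb t ht
    exact le_of_lt (hs ⟨ht.1, ht.2.trans hb.2⟩)
  -- constants
  set L := ∑ j, 2 / m₀ j with hL
  have hL0 : 0 ≤ L := Finset.sum_nonneg fun j _ => by have := hm₀ j; positivity
  have hLj : ∀ j, 2 / m₀ j ≤ L := fun j => Finset.single_le_sum (f := fun j => 2 / m₀ j)
    (fun j _ => by have := hm₀ j; positivity) (Finset.mem_univ j)
  set B := BΦ + C₀ + 1 with hB
  have hB0 : 0 ≤ B := by positivity
  -- The order of choices avoids a circle: `A` must dominate the accelerations, hence the force,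
  -- while the Lipschitz constant `M` of `F₀` depends on `A`. So `B` uses only the size of `F₀` on
  -- the reference trajectory, which moves on uniformly after `s`; the final `+ 1` in `B` absorbs
  -- the deviation of `F₀`, which is less than `1` on a short interval.
  set A := max A₀ (L * B) with hA
  have hA0 : 0 ≤ A := hA₀.trans (le_max_left _ _)
  obtain ⟨e, hreg, hse⟩ :=
    ((eventually_isRegularDomain hx hsep hκ0 hκlt hA0).and self_mem_nhdsWithin).exists
  replace hse : s < e := hse
  obtain ⟨M, hM0, hM⟩ := hF₀.exists_bound hreg
  have hself : ∀ᶠ b in 𝓝[>] s, b ∈ Ioi s := self_mem_nhdsWithin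
  -- The smallness conditions serve, in turn: `F₀` on the reference trajectory stays below `C₀`;
  -- speeds stay below `κ`; `F₀` deviates by less than `1`; the states stay where `Φ` is Lipschitz;
  -- the map contracts by `1 / 2`; position differences do not exceed velocity differences.
  obtain ⟨b, hb1, hb2, hb3, hb4, hb5, hb6, hb7, hbe, hbb₀⟩ :=
    (hF₀xr.and <| (eventually_mul_sub_lt A s (sub_pos.2 hκκ₀)).and <|
      (eventually_mul_sub_lt (M * (2 + A)) s one_pos).and <|
      (eventually_mul_sub_lt (1 + A) s hδ0).and <|
      (eventually_mul_sub_lt (L * (M + C)) s (half_pos one_pos)).and <|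
      (eventually_mul_sub_lt 1 s one_pos).and <|
      hself.and <|
      ((show ∀ᶠ b in 𝓝[>] s, b ∈ Ioc s e from Ioc_mem_nhdsGT hse).and
        (show ∀ᶠ b in 𝓝[>] s, b ∈ Ioc s b₀ from Ioc_mem_nhdsGT hb₀))).exists
  replace hb7 : s < b := hb7
  have hsb : s ≤ b := hb7.le
  -- trajectories with velocities in the space
  set X := x.velSpace hsb A with hX
  set Y : X → Traj n := fun V => x.ofVel s (x.extendVel hsb V.1) with hY
  have hUl : ∀ V : X, ∀ j t t', ‖x.extendVel hsb V.1 t j - x.extendVel hsb V.1 t' j‖ ≤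
      A * |t - t'| := fun V => extendVel_lip hxP (le_max_left _ _) hA0 V.2.1 V.2.2
  have hUx : ∀ V : X, ∀ j, ∀ t ≤ s, x.extendVel hsb V.1 t j = x.vel j t := fun V j t ht => by
    rw [extendVel_of_le ht]
  have hUV : ∀ V : X, ∀ t (ht : t ∈ Icc s b), x.extendVel hsb V.1 t = V.1 ⟨t, ht⟩ :=
    fun V t ht => by rw [extendVel_of_ge V.2.1 ht.1, projIcc_of_mem]
  have hUκ : ∀ V : X, ∀ j t, ‖x.extendVel hsb V.1 t j‖ ≤ κ := by
    intro V j t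
    rcases le_total t s with ht | ht
    · rw [hUx V j t ht]; exact ((hxP j).norm_vel_le' ht).trans hκκ₀.le
    · rw [extendVel_of_ge V.2.1 ht]
      have h1 := V.2.2 j (projIcc s b hsb t) ⟨s, le_rfl, hsb⟩
      rw [V.2.1 j] at h1
      have h2 := norm_le_norm_add_norm_sub' (V.1 (projIcc s b hsb t) j) (x.vel j s)
      have h3 := (hxP j).norm_vel_le' le_rfl
      have h4 : |(projIcc s b hsb t : ℝ) - s| ≤ b - s := by
        have := (projIcc s b hsb t).2
        rw [abs_of_nonneg (by linarith [this.1])]; linarith [this.2]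
      have h5 := mul_le_mul_of_nonneg_left h4 hA0
      simp only at h1
      linarith
  have hYP : ∀ V j, IsPath ((Y V).pos j) ((Y V).vel j) b κ A := fun V =>
    isPath_ofVel hκ0 hκlt (hUl V) (hUκ V) b
  have hYx : ∀ V, EqOn (Y V) x (Iic s) := fun V => ofVel_eqOn hxP (hUl V) (hUx V)
  have hYD : ∀ V, Y V ∈ x.initialDomain κ A s b := fun V => mem_initialDomain (hYx V) (hYP V)
  have hxrD : xr ∈ x.initialDomain κ A s b := mem_initialDomain hxrx fun j =>
    (hxrP b j).mono_const hκκ₀.le hκlt (le_max_left _ _)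
  have hYs : ∀ V j, (Y V).pos j s = x.pos j s ∧ (Y V).vel j s = x.vel j s := fun V j =>
    ⟨pos_eqOn (hYx V) j self_mem_Iic, vel_eqOn (hYx V) j self_mem_Iic⟩
  have hYball : ∀ V, ∀ t ∈ Icc s b, ∀ j,
      (((Y V).pos j t, (Y V).vel j t), t) ∈ Metric.ball ((x.pos j s, x.vel j s), s) δ := by
    intro V t ht j
    have h1 := (hYP V j).pos_lip t ht.2 s hsb
    have h2 := (hYP V j).vel_lip t ht.2 s hsb
    rw [(hYs V j).1] at h1
    rw [(hYs V j).2] at h2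
    have h3 : |t - s| ≤ b - s := by rw [abs_of_nonneg (by linarith [ht.1])]; linarith [ht.2]
    have h4 := mul_le_mul_of_nonneg_left h3 hA0
    have h5 := mul_le_mul_of_nonneg_left h3 hκ0
    have h6 : κ * (b - s) ≤ 1 * (b - s) := mul_le_mul_of_nonneg_right hκlt.le (by linarith)
    have h7 : 0 ≤ A * (b - s) := mul_nonneg hA0 (by linarith)
    rw [mem_ball_iff_norm]
    refine max_lt (max_lt ?_ ?_) ?_
    · simp only [Prod.fst_sub]; linarith
    · simp only [Prod.fst_sub, Prod.snd_sub]; linarith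
    · simp only [Prod.snd_sub, Real.norm_eq_abs]; linarith
  -- the force
  set f : X → Fin n → ℝ → E3 := fun V j t =>
    Φ j (((Y V).pos j t, (Y V).vel j t), t) + F₀ (Y V) t j with hf
  have hfc : ∀ V j, ContinuousOn (f V j) (Icc s b) := by
    intro V j
    have h1 : ContinuousOn (Φ j) (UΦ j) := by
      have : LipschitzOnWith (Real.toNNReal (CΦ j)) (Φ j) (UΦ j) :=
        LipschitzOnWith.of_dist_le_mul fun p hp p' hp' => by
          rw [dist_eq_norm, dist_eq_norm, Real.coe_toNNReal _ (hCΦ j)]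
          exact hΦl j p hp p' hp'
      exact this.continuousOn
    have h2 : ContinuousOn (fun t => (((Y V).pos j t, (Y V).vel j t), t)) (Icc s b) :=
      ((hYP V j).continuousOn.prodMk (hYP V j).continuousOn_vel).mono Icc_subset_Iic_self
        |>.prodMk continuousOn_id
    have h3 : ContinuousOn (F₀ (Y V)) (Icc s b) :=
      (hF₀.1.1 b (Y V) (memSpace_of_isPath hκlt (hYP V))).mono Icc_subset_Iic_self
    exact (h1.comp h2 fun t ht => hδ j (hYball V t ht j)).add (continuousOn_pi.1 h3 j)
  have hfB : ∀ V j, ∀ t ∈ Icc s b, ‖f V j t‖ ≤ B := by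
    intro V j t ht
    have h1 : ‖Φ j (((Y V).pos j t, (Y V).vel j t), t)‖ ≤ BΦ := by
      have h2 := hΦl j _ (hδ j (hYball V t ht j)) _ (hδ j (Metric.mem_ball_self hδ0))
      have h3 := mem_ball_iff_norm.1 (hYball V t ht j)
      have h4 := norm_le_norm_add_norm_sub' (Φ j (((Y V).pos j t, (Y V).vel j t), t))
        (Φ j ((x.pos j s, x.vel j s), s))
      have h5 : ‖Φ j ((x.pos j s, x.vel j s), s)‖ ≤ ∑ j, ‖Φ j ((x.pos j s, x.vel j s), s)‖ :=
        Finset.single_le_sum (f := fun j => ‖Φ j ((x.pos j s, x.vel j s), s)‖)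
          (fun j _ => norm_nonneg _) (Finset.mem_univ j)
      have h6 := mul_le_mul (hCj j) h3.le (norm_nonneg _) hC0
      linarith
    have hdiff : ∀ t ∈ Icc s b, ‖Y V t - xr t‖ ≤ (2 + A) * (b - s) := by
      intro t ht
      have hbs : 0 ≤ b - s := by linarith
      rw [norm_sub_le_iff (by positivity)]
      intro j
      have h3 : |t - s| ≤ b - s := by rw [abs_of_nonneg (by linarith [ht.1])]; linarith [ht.2]
      have h4 := mul_le_mul_of_nonneg_left h3 hA0
      have h7 : 0 ≤ A * (b - s) := mul_nonneg hA0 hbs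
      constructor
      · have h1 := (hYP V j).pos_lip t ht.2 s hsb
        have h2 := (hxrP b j).pos_lip t ht.2 s hsb
        rw [(hYs V j).1] at h1
        rw [show (x.ofVel s _).pos j s = x.pos j s from pos_eqOn hxrx j self_mem_Iic] at h2
        have h5 := norm_sub_le_norm_sub_add_norm_sub ((Y V).pos j t) (x.pos j s) (xr.pos j t)
        rw [norm_sub_rev (x.pos j s)] at h5
        have h8 : κ * |t - s| ≤ 1 * (b - s) := mul_le_mul hκlt.le h3 (abs_nonneg _) one_pos.le
        have h9 : κ₀ * |t - s| ≤ 1 * (b - s) := mul_le_mul hκ₀1.le h3 (abs_nonneg _) one_pos.le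
        linarith
      · have h1 := (hYP V j).vel_lip t ht.2 s hsb
        rw [(hYs V j).2] at h1
        have : xr.vel j t = x.vel j s := by
          change x.vel j (min t s) = _
          rw [min_eq_right ht.1]
        rw [this]
        linarith
    have h2 := hM b ⟨hsb, hbe.2⟩ _ (hYD V) _ hxrD _ hdiff t ht
    have h3 : ‖F₀ (Y V) t j‖ ≤ C₀ + 1 := by
      have h4 := norm_le_pi_norm (F₀ (Y V) t) j
      have h5 := norm_le_norm_add_norm_sub' (F₀ (Y V) t) (F₀ xr t)
      have h6 := hb1 t ht
      linarith
    exact (norm_add_le _ _).trans (by linarith)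
  have hfl : ∀ V V' j, ∀ t ∈ Icc s b, ‖f V j t - f V' j t‖ ≤ (M + C) * dist V V' := by
    intro V V' j t ht
    have hvel : ∀ j, ∀ t ∈ Icc s b, ‖(Y V).vel j t - (Y V').vel j t‖ ≤ dist V V' := by
      intro j t ht
      change ‖x.extendVel hsb V.1 t j - x.extendVel hsb V'.1 t j‖ ≤ _
      rw [hUV V t ht, hUV V' t ht]
      refine (norm_le_pi_norm (V.1 ⟨t, ht⟩ - V'.1 ⟨t, ht⟩) j).trans ?_
      rw [← dist_eq_norm]
      exact ContinuousMap.dist_apply_le_dist _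
    have hdiff : ∀ t ∈ Icc s b, ‖Y V t - Y V' t‖ ≤ dist V V' := by
      intro t ht
      rw [norm_sub_le_iff dist_nonneg]
      refine fun j => ⟨?_, hvel j t ht⟩
      have h1 : ∀ t ∈ Icc s b, HasDerivWithinAt (fun t => (Y V).pos j t - (Y V').pos j t)
          ((Y V).vel j t - (Y V').vel j t) (Icc s b) t := fun t ht =>
        (((hYP V j).hasDeriv t ht.2).sub ((hYP V' j).hasDeriv t ht.2)).mono Icc_subset_Iic_self
      have h2 := (convex_Icc s b).norm_image_sub_le_of_norm_hasDerivWithin_le h1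
        (fun t ht => hvel j t ht) ⟨le_rfl, hsb⟩ ht
      rw [(hYs V j).1, (hYs V' j).1, sub_self, sub_zero, Real.norm_eq_abs,
        abs_of_nonneg (by linarith [ht.1])] at h2
      refine h2.trans ?_
      have h3 : t - s ≤ 1 := by linarith [ht.2]
      nlinarith [dist_nonneg (x := V) (y := V')]
    have h1 := hM b ⟨hsb, hbe.2⟩ _ (hYD V) _ (hYD V') _ hdiff t ht
    have h2 := (norm_le_pi_norm (F₀ (Y V) t - F₀ (Y V') t) j).trans h1
    rw [Pi.sub_apply] at h2
    have h3 := hΦl j _ (hδ j (hYball V t ht j)) _ (hδ j (hYball V' t ht j))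
    have h4 : ‖((((Y V).pos j t, (Y V).vel j t), t) : (E3 × E3) × ℝ) -
        (((Y V').pos j t, (Y V').vel j t), t)‖ ≤ dist V V' := by
      refine max_le ?_ (by simp)
      exact max_le ((norm_pos_sub_le _ _ j t).trans (hdiff t ht)) (hvel j t ht)
    have h5 := mul_le_mul (hCj j) h4 (norm_nonneg _) hC0
    have h6 : f V j t - f V' j t = (Φ j (((Y V).pos j t, (Y V).vel j t), t) -
        Φ j (((Y V').pos j t, (Y V').vel j t), t)) + (F₀ (Y V) t j - F₀ (Y V') t j) := by
      simp only [hf]; abel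
    rw [h6]
    exact (norm_add_le _ _).trans (by linarith)
  -- the contraction
  choose p hps hpd using fun V j => exists_primitive hsb (hfc V j) (x.momentum m₀ j s)
  have hpl : ∀ V j, ∀ t ∈ Icc s b, ∀ t' ∈ Icc s b, ‖p V j t - p V j t'‖ ≤ B * |t - t'| :=
    fun V j t ht t' ht' => (convex_Icc s b).norm_image_sub_le_of_norm_hasDerivWithin_le (hpd V j)
      (hfB V j) ht' ht
  -- One Picard step: the force along the trajectory with velocities `V` is integrated to momenta,
  -- which are converted back to velocities. These are automatically slower than light.
  set T₀ : X → C(Icc s b, Fin n → E3) := fun V =>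
    ⟨fun t j => velOfMomentum (m₀ j) (p V j t), continuous_pi fun j =>
      (differentiable_velOfMomentum (hm₀ j)).continuous.comp
        (continuousOn_iff_continuous_domRestrict.1 fun t ht =>
          (hpd V j t ht).continuousWithinAt)⟩ with hT₀
  have hT₀X : ∀ V, T₀ V ∈ X := by
    intro V
    constructor
    · intro j
      change velOfMomentum (m₀ j) (p V j s) = _
      rw [hps]
      exact velOfMomentum_momentum (hm₀ j) (((hxP j).norm_vel_le' le_rfl).trans_lt hκ₀1)
    · intro j t t'
      refine (norm_velOfMomentum_sub_le (hm₀ j) _ _).trans ?_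
      refine (mul_le_mul (hLj j) (hpl V j t t.2 t' t'.2) (norm_nonneg _) hL0).trans ?_
      rw [← mul_assoc]
      exact mul_le_mul_of_nonneg_right (le_max_right _ _) (abs_nonneg _)
  set T : X → X := fun V => ⟨T₀ V, hT₀X V⟩ with hT
  have hTc : ContractingWith (1 / 2) T := by
    refine ⟨by norm_num, LipschitzWith.of_dist_le_mul fun V V' => ?_⟩
    have hh : ((1 / 2 : NNReal) : ℝ) = 1 / 2 := by norm_num
    rw [hh]
    change dist (T₀ V) (T₀ V') ≤ _
    have hd0 := dist_nonneg (x := V) (y := V')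
    rw [ContinuousMap.dist_le (by positivity)]
    intro t
    rw [dist_pi_le_iff (by positivity)]
    intro j
    rw [dist_eq_norm]
    refine (norm_velOfMomentum_sub_le (hm₀ j) _ _).trans ?_
    have h1 : ‖p V j t - p V' j t‖ ≤ (M + C) * dist V V' * (b - s) := by
      have h2 := (convex_Icc s b).norm_image_sub_le_of_norm_hasDerivWithin_le
        (fun t ht => (hpd V j t ht).sub (hpd V' j t ht)) (hfl V V' j) ⟨le_rfl, hsb⟩ t.2
      simp only [Pi.sub_apply, hps, sub_self, sub_zero] at h2
      refine h2.trans ?_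
      rw [Real.norm_eq_abs, abs_of_nonneg (by linarith [t.2.1])]
      gcongr
      exact t.2.2
    refine (mul_le_mul (hLj j) h1 (norm_nonneg _) hL0).trans ?_
    nlinarith
  have : CompleteSpace X := (isClosed_velSpace x hsb A).isComplete.completeSpace_coe
  have : Nonempty X := by
    refine ⟨⟨ContinuousMap.const _ fun j => x.vel j s, fun j => rfl, fun j t t' => ?_⟩⟩
    simp only [ContinuousMap.const_apply, sub_self, norm_zero]
    positivity
  set V := hTc.fixedPoint with hV
  have hVfix : T V = V := hTc.fixedPoint_isFixedPt
  refine ⟨b, hbb₀, Y V, hYx V, memSpace_of_isPath hκlt (hYP V), fun t ht j => ?_⟩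
  have hmom : ∀ t ∈ Icc s b, (Y V).momentum m₀ j t = p V j t := by
    intro t ht
    have h1 : (Y V).vel j t = velOfMomentum (m₀ j) (p V j t) := by
      change x.extendVel hsb V.1 t j = _
      rw [hUV V t ht]
      conv_lhs => rw [← hVfix]
      rfl
    rw [momentum, h1, momentum_velOfMomentum (hm₀ j)]
  exact (hpd V j t ht).congr hmom (hmom t ht)

end Traj

/-! ### Existence of a solution on a short interval -/

theorem Traj.IsAdmissible.memSpace {n : ℕ} {x : Traj n} {s : ℝ} (hx : x.IsAdmissible s) :
    x.MemSpace s := by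
  obtain ⟨hk, h3, hκ, A, hA⟩ := hx
  refine ⟨hk, hκ, A, fun j t ht t' ht' => ?_⟩
  have hu : UniqueDiffOn ℝ (Iic s) := uniqueDiffOn_Iic s
  have hv : EqOn (x.vel j) (derivWithin (x.pos j) (Iic s)) (Iic s) := fun t ht =>
    ((hk j t ht).derivWithin (hu t ht)).symm
  have hd : DifferentiableOn ℝ (x.vel j) (Iic s) :=
    (((h3 j).derivWithin hu (m := 2) (by norm_num)).differentiableOn two_ne_zero).congr hv
  refine (convex_Iic s).norm_image_sub_le_of_norm_derivWithin_le hd (fun t ht => ?_) ht' ht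
  have h1 := hA j t ht
  rw [iteratedDerivWithin_succ] at h1
  have h2 : derivWithin (iteratedDerivWithin 1 (x.pos j) (Iic s)) (Iic s) t =
      derivWithin (x.vel j) (Iic s) t := by
    refine derivWithin_congr (fun t ht => ?_) ?_
    · rw [iteratedDerivWithin_one, hv ht]
    · rw [iteratedDerivWithin_one, hv ht]
  rwa [h2] at h1

/-- Local existence of a solution that extends an admissible initial trajectory. -/
theorem exists_isSolution {n : ℕ} {m₀ : Fin n → ℝ} (q : Fin n → ℝ) (hm₀ : ∀ j, 0 < m₀ j)
    {F₀ : Traj n → ℝ → Fin n → E3} (hF₀ : IsRegularNonanticipating F₀) {s : ℝ} {x : Traj n}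
    (hx : x.IsAdmissible s) (hsep : 0 < x.sep s) :
    ∃ b, s < b ∧ ∃ y, IsSolution m₀ q F₀ s x (Icc s b) y := by
  have hxs := hx.memSpace
  obtain ⟨κ, A, hκ0, hκ1, hA0, hP⟩ := hxs.exists_isPath
  -- The initial path is smooth only from the left at `s`, but the retarded times that matter lie
  -- strictly before `s`.
  have h3 : ∀ k, ∀ σ < s, ContDiffAt ℝ 3 (x.pos k) σ := fun k σ hσ =>
    (hx.2.1 k).contDiffAt (Iic_mem_nhds hσ)
  have hoff : ∀ j k, j ≠ k → OffPath (x.pos k) s (x.pos j s) s := fun j k hjk =>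
    (hP k).offPath_of_le le_rfl (by
      have := norm_pos_iff.2 (sub_ne_zero.2 (Traj.pos_ne_of_sep_pos hsep hjk)); linarith)
  -- a neighbourhood of the initial positions
  have hnear : ∀ᶠ ε in 𝓝[>] (0 : ℝ), ∀ j k, j ≠ k →
      ∀ z ∈ Metric.ball ((x.pos j s, s) : E3 × ℝ) ε, OffPath (x.pos k) s z.1 z.2 := by
    rw [eventually_all]; intro j
    rw [eventually_all]; intro k
    by_cases hjk : j = k
    · exact Eventually.of_forall fun ε h => absurd hjk h
    obtain ⟨ε, hε, hball⟩ := Metric.eventually_nhds_iff_ball.1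
      ((hP k).eventually_offPath (hoff j k hjk))
    have : ∀ᶠ ε' in 𝓝[>] (0 : ℝ), ε' ∈ Ioc 0 ε := Ioc_mem_nhdsGT hε
    filter_upwards [this] with ε' hε' _ z hz using hball z (Metric.ball_subset_ball hε'.2 hz)
  have hself : ∀ᶠ ε in 𝓝[>] (0 : ℝ), ε ∈ Ioi 0 := self_mem_nhdsWithin
  obtain ⟨ε, hε, hε0⟩ := (hnear.and hself).exists
  replace hε0 : 0 < ε := hε0
  -- the fields of the initial trajectory
  set Φ : Fin n → (E3 × E3) × ℝ → E3 := fun j p =>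
    ∑ k ∈ Finset.univ.filter (fun k => k ≠ j),
      forceOp (q j) (m₀ k) (sepVec (x.pos k) s p.1.1 p.2, p.1.2)
        (Field.newtonFeynman (x.pos k) s p.1.1 p.2) with hΦdef
  have hΦ : ∀ j, ContDiffAt ℝ 1 (Φ j) ((x.pos j s, x.vel j s), s) := by
    intro j
    refine ContDiffAt.sum fun k hk => ?_
    have ho := hoff j k (Finset.mem_filter.1 hk).2.symm
    have hproj : ContDiffAt ℝ 1 (fun p : (E3 × E3) × ℝ => ((p.1.1, p.2) : E3 × ℝ))
        ((x.pos j s, x.vel j s), s) := by fun_prop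
    have hvel : ContDiffAt ℝ 1 (fun p : (E3 × E3) × ℝ => p.1.2)
        ((x.pos j s, x.vel j s), s) := by fun_prop
    have h1 : ContDiffAt ℝ 1 (fun z : E3 × ℝ => sepVec (x.pos k) s z.1 z.2) (x.pos j s, s) :=
      ((hP k).contDiffAt_sepVec ho (by norm_num) (h3 k)).of_le (by norm_num)
    have h2 := (hP k).contDiffAt_newtonFeynman ho (h3 k)
    have h4 := (ContDiffAt.comp ((x.pos j s, x.vel j s), s)
      (f := fun p : (E3 × E3) × ℝ => ((p.1.1, p.2) : E3 × ℝ)) h1 hproj).prodMk hvel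
    have h5 : ContDiffAt ℝ 1 (forceOp (q j) (m₀ k)) (sepVec (x.pos k) s (x.pos j s) s, x.vel j s) :=
      contDiffAt_forceOp _ _ ((hP k).sepVec_ne ho)
    exact (ContDiffAt.comp ((x.pos j s, x.vel j s), s) h5 h4).clm_apply
      (ContDiffAt.comp ((x.pos j s, x.vel j s), s)
        (f := fun p : (E3 × E3) × ℝ => ((p.1.1, p.2) : E3 × ℝ)) h2 hproj)
  obtain ⟨b, hb, y, hyx, hyb, hyeq⟩ := Traj.exists_local_solution hm₀ hF₀ hxs hsep hΦ
    (show s < s + ε / 2 by linarith)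
  obtain ⟨κ', A', hκ0', hκ1', hA0', hyP⟩ := hyb.exists_isPath
  have hmove : ∀ t ∈ Icc s b, ∀ j, ‖y.pos j t - x.pos j s‖ ≤ t - s := by
    intro t ht j
    have h1 := (hyP j).pos_lip t ht.2 s hb.1.le
    rw [Traj.pos_eqOn hyx j self_mem_Iic, abs_of_nonneg (by linarith [ht.1])] at h1
    nlinarith [ht.1]
  have hoff' : ∀ t ∈ Icc s b, ∀ j k, j ≠ k → OffPath (x.pos k) s (y.pos j t) t := by
    intro t ht j k hjk
    refine hε j k hjk (y.pos j t, t) ?_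
    have h1 := hmove t ht j
    have h2 : t - s < ε := by linarith [ht.2, hb.2]
    rw [mem_ball_iff_norm]
    refine max_lt (h1.trans_lt h2) ?_
    rw [Prod.snd_sub, Real.norm_eq_abs, abs_of_nonneg (by simpa using ht.1)]
    exact h2
  refine ⟨b, hb.1, y, hyx, fun t ht => hyb.mono ht.2, fun t ht => ?_, fun t ht j k hjk => ?_,
    fun t ht j => ?_⟩
  -- At a collision of `j` and `k` at time `t`, body `k` would be farther than `t - s` from its own
  -- position at time `s`, contrary to the speed bound.
  · rw [Traj.sep_pos_iff]
    intro j k hjk heq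
    have h1 := (hoff' t ht j k hjk).1
    rw [heq] at h1
    linarith [hmove t ht k]
  · exact ((hP k).exists_congr ((hyP k).mono ht.2) ht.1 (Traj.pos_eqOn hyx k)
      (hoff' t ht j k hjk).1).2 ((hP k).exists_of_contDiffAt (hoff' t ht j k hjk) (h3 k))
  · have h1 : y.lorentzNewton m₀ q j t = Φ j ((y.pos j t, y.vel j t), t) := by
      refine Finset.sum_congr rfl fun k hk => ?_
      have hjk := (Finset.mem_filter.1 hk).2.symm
      exact Traj.opH_eq_forceOp m₀ q ht.1 (hP k) ((hyP k).mono ht.2) hyx (hoff' t ht j k hjk).1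
    rw [h1]
    exact hyeq t ht j

/-! ### Uniqueness on common intervals -/

namespace IsSolution

variable {n : ℕ} {m₀ q : Fin n → ℝ} {F₀ : Traj n → ℝ → Fin n → E3} {s : ℝ} {x : Traj n}
  {I I' : Set ℝ} {y z : Traj n}

theorem solvesOn (hy : IsSolution m₀ q F₀ s x I y) {a b : ℝ} (hb : b ∈ I)
    (hsub : Icc a b ⊆ I) : SolvesOn m₀ q F₀ a b y where
  memSpace := hy.memSpace b hb
  fieldExists t ht := hy.fieldExists t (hsub ht)
  equation t ht j := (hy.equation t (hsub ht) j).mono hsub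

/-- Two solutions that extend the same initial trajectory agree where both are defined. -/
theorem eqOn_Iic (hm₀ : ∀ j, 0 < m₀ j) (hF₀ : IsRegularNonanticipating F₀)
    (hI : IsIntervalFrom s I) (hI' : IsIntervalFrom s I') (hy : IsSolution m₀ q F₀ s x I y)
    (hz : IsSolution m₀ q F₀ s x I' z) {t : ℝ} (ht : t ∈ I) (ht' : t ∈ I') :
    EqOn z y (Iic t) := by
  have hst := hI.2.2.1 t ht
  have hsub : Icc s t ⊆ I := hI.1.out hI.2.1 ht
  have hsub' : Icc s t ⊆ I' := hI'.1.out hI'.2.1 ht'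
  obtain ⟨κ₁, A₁, -, -, -, hyP⟩ := (hy.memSpace t ht).exists_isPath
  obtain ⟨κ₂, A₂, -, -, -, hzP⟩ := (hz.memSpace t ht').exists_isPath
  have hs : EqOn z y (Iic s) := hz.extends_initial.trans hy.extends_initial.symm
  -- Continuous induction: the times up to which the solutions agree form a closed set by continuity
  -- of the trajectories, and local uniqueness moves every such time before `t` to the right.
  have key : Icc s t ⊆ {a | EqOn z y (Iic a)} := by
    refine IsClosed.Icc_subset_of_forall_exists_gt ?_ hs ?_
    · refine isClosed_of_closure_subset fun a ha => ?_
      have hat : a ∈ Icc s t := closure_minimal inter_subset_right isClosed_Icc ha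
      refine ⟨EqOn.of_subset_closure (s := Iio a) (fun u hu => ?_)
        ((Traj.continuousOn_of_isPath hzP).mono (Iic_subset_Iic.2 hat.2))
        ((Traj.continuousOn_of_isPath hyP).mono (Iic_subset_Iic.2 hat.2))
        Iio_subset_Iic_self (closure_Iio a).ge, hat⟩
      obtain ⟨a', hua', ha', -⟩ := mem_closure_iff_nhds.1 ha _ (Ioi_mem_nhds hu)
      exact ha' (show u ≤ a' from le_of_lt hua')
    · rintro a ⟨ha, hat⟩ c hac
      have hac' : a < min c t := lt_min hac hat.2
      have h1 : Icc a (min c t) ⊆ Icc s t :=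
        Icc_subset_Icc hat.1 (min_le_right _ _)
      have h2 : min c t ∈ Icc s t := h1 ⟨hac'.le, le_rfl⟩
      obtain ⟨d, hd, hde⟩ := SolvesOn.exists_eqOn hm₀ hF₀ hac'
        (hy.solvesOn (hsub h2) (h1.trans hsub)) (hz.solvesOn (hsub' h2) (h1.trans hsub')) ha
        (hy.sep_pos a (hsub ⟨hat.1, hat.2.le⟩))
      exact ⟨d, hde, hd.1, hd.2.trans (min_le_left _ _)⟩
  exact key ⟨hst, le_rfl⟩

/-- All conditions on a solution at time `t`, apart from the derivative of the momentum, look only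
at the trajectory up to `t`: the fields by retardation and positive separation, `F₀` because it is
nonanticipating. -/
theorem congr (hF₀ : IsRegularNonanticipating F₀)
    (hy : IsSolution m₀ q F₀ s x I y) {t : ℝ} (ht : t ∈ I) (he : EqOn z y (Iic t)) :
    z.MemSpace t ∧ 0 < z.sep t ∧ (∀ j k, j ≠ k → z.FieldExists j k t) ∧
    ∀ j, z.lorentzNewton m₀ q j t + F₀ z t j = y.lorentzNewton m₀ q j t + F₀ y t j := by
  have hym := hy.memSpace t ht
  have hzm : z.MemSpace t := hym.congr he
  obtain ⟨κ₁, A₁, -, -, -, hyP⟩ := hym.exists_isPath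
  obtain ⟨κ₂, A₂, -, -, -, hzP⟩ := hzm.exists_isPath
  have hzt : z t = y t := he self_mem_Iic
  have hpos : ∀ j, z.pos j t = y.pos j t := fun j => Traj.pos_eqOn he j self_mem_Iic
  have hvel : ∀ j, z.vel j t = y.vel j t := fun j => Traj.vel_eqOn he j self_mem_Iic
  have harr : ∀ j k, j ≠ k → t < t + ‖y.pos j t - y.pos k t‖ := fun j k hjk => by
    have := norm_pos_iff.2 (sub_ne_zero.2 (Traj.pos_ne_of_sep_pos (hy.sep_pos t ht) hjk))
    linarith
  refine ⟨hzm, ?_, fun j k hjk => ?_, fun j => ?_⟩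
  · rw [Traj.sep_congr hzt]; exact hy.sep_pos t ht
  · rw [Traj.FieldExists, hpos]
    exact ((hyP k).exists_congr (hzP k) le_rfl (Traj.pos_eqOn he k) (harr j k hjk)).2
      (hy.fieldExists t ht j k hjk)
  · rw [hF₀.1.2 t z y hzm hym he self_mem_Iic]
    congr 1
    refine Finset.sum_congr rfl fun k hk => ?_
    have hjk := (Finset.mem_filter.1 hk).2.symm
    rw [Traj.opH, Traj.opH, Traj.fieldOn, Traj.fieldOn, Traj.unitVec, Traj.unitVec, hpos, hvel,
      (hyP k).newtonFeynman_congr (hzP k) le_rfl (Traj.pos_eqOn he k) (harr j k hjk),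
      (hyP k).e_congr (hzP k) le_rfl (Traj.pos_eqOn he k) (harr j k hjk).le]

end IsSolution

end

/-! ### Gluing all solutions to the maximal one -/

theorem mainTheorem3 (n : ℕ) (m₀ q : Fin n → ℝ) (hm₀ : ∀ j, 0 < m₀ j)
    (F₀ : Traj n → ℝ → Fin n → E3) (hF₀ : IsRegularNonanticipating F₀)
    (s : ℝ) (x : Traj n) (hx : x.IsAdmissible s) (hsep : 0 < x.sep s) :
    ∃ (I : Set ℝ) (y : Traj n), IsIntervalFrom s I ∧ IsSolution m₀ q F₀ s x I y ∧
      ∀ (I' : Set ℝ) (y' : Traj n), IsIntervalFrom s I' → IsSolution m₀ q F₀ s x I' y' →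
        I' ⊆ I ∧ EqOn y' y I' := by
  obtain ⟨b, hb, y₀, hy₀⟩ := exists_isSolution q hm₀ hF₀ hx hsep
  have hI₀ : IsIntervalFrom s (Icc s b) :=
    ⟨ordConnected_Icc, ⟨le_rfl, hb.le⟩, fun t ht => ht.1, b, ⟨hb.le, le_rfl⟩, hb⟩
  let good : ℝ → Set ℝ × Traj n → Prop := fun t S =>
    IsIntervalFrom s S.1 ∧ IsSolution m₀ q F₀ s x S.1 S.2 ∧ t ∈ S.1
  set I : Set ℝ := {t | ∃ S, good t S} with hI
  have hex : ∀ t : I, ∃ S, good t S := fun t => t.2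
  choose S hS using hex
  classical
  -- Each time in `I` uses its own chosen solution; uniqueness makes the choices compatible. The
  -- default `x` supplies the initial trajectory before `s`, and its values beyond `I` play no role.
  set y : Traj n := fun t => if h : t ∈ I then (S ⟨t, h⟩).2 t else x t with hy
  -- the glued trajectory agrees with every solution
  have hglue : ∀ I' y', IsIntervalFrom s I' → IsSolution m₀ q F₀ s x I' y' → ∀ t ∈ I',
      EqOn y y' (Iic t) := by
    intro I' y' hI' hy' t ht u hu
    rcases lt_or_ge u s with hus | hsu
    · have : u ∉ I := fun ⟨S', h1, _, h2⟩ => hus.not_ge (h1.2.2.1 u h2)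
      simp only [hy, this, dif_neg, not_false_eq_true]
      exact (hy'.extends_initial hus.le).symm
    · have huI' : u ∈ I' := hI'.1.out hI'.2.1 ht ⟨hsu, hu⟩
      have huI : u ∈ I := ⟨(I', y'), hI', hy', huI'⟩
      simp only [hy, huI, dif_pos]
      obtain ⟨h1, h2, h3⟩ := hS ⟨u, huI⟩
      exact IsSolution.eqOn_Iic hm₀ hF₀ hI' h1 hy' h2 huI' h3 self_mem_Iic
  have hIint : IsIntervalFrom s I := by
    refine ⟨⟨?_⟩, ⟨(Icc s b, y₀), hI₀, hy₀, hI₀.2.1⟩, fun t ht => ?_,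
      b, ⟨(Icc s b, y₀), hI₀, hy₀, hb.le, le_rfl⟩, hb⟩
    · rintro t₁ ⟨S₁, h1, -, ht₁⟩ t₂ ⟨S₂, h2, h3, ht₂⟩ t ht
      exact ⟨S₂, h2, h3, h2.1.out h2.2.1 ht₂ ⟨(h1.2.2.1 t₁ ht₁).trans ht.1, ht.2⟩⟩
    · obtain ⟨S', h1, -, h2⟩ := ht
      exact h1.2.2.1 t h2
  refine ⟨I, y, hIint, ?_, fun I' y' hI' hy' => ⟨fun t ht => ⟨(I', y'), hI', hy', ht⟩,
    fun t ht => (hglue I' y' hI' hy' t ht self_mem_Iic).symm⟩⟩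
  have hcongr : ∀ t ∈ I, ∃ I' y', IsIntervalFrom s I' ∧ IsSolution m₀ q F₀ s x I' y' ∧ t ∈ I' ∧
      EqOn y y' (Iic t) := fun t ⟨S', h1, h2, h3⟩ => ⟨S'.1, S'.2, h1, h2, h3, hglue _ _ h1 h2 t h3⟩
  refine ⟨(hglue _ _ hI₀ hy₀ s hI₀.2.1).trans hy₀.extends_initial, fun t ht => ?_, fun t ht => ?_,
    fun t ht => ?_, fun t ht j => ?_⟩
  · obtain ⟨I', y', h1, h2, h3, h4⟩ := hcongr t ht
    exact (h2.congr hF₀ h3 h4).1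
  · obtain ⟨I', y', h1, h2, h3, h4⟩ := hcongr t ht
    exact (h2.congr hF₀ h3 h4).2.1
  · obtain ⟨I', y', h1, h2, h3, h4⟩ := hcongr t ht
    exact (h2.congr hF₀ h3 h4).2.2.1
  · -- a solution whose interval is a neighbourhood of `t` in `I`
    have : ∃ I' y', IsIntervalFrom s I' ∧ IsSolution m₀ q F₀ s x I' y' ∧ t ∈ I' ∧ I' ∈ 𝓝[I] t := by
      -- A solution that lives only up to `t` would control just the left derivative. If `I` extends
      -- beyond `t`, a solution reaching a later time is used; if `t` is the last point of `I`, the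
      -- interval of any solution reaching `t` already contains all of `I`.
      by_cases hmax : ∃ t₂ ∈ I, t < t₂
      · obtain ⟨t₂, ⟨S', h1, h2, h3⟩, ht₂⟩ := hmax
        have hst := hIint.2.2.1 t ht
        refine ⟨S'.1, S'.2, h1, h2, h1.1.out h1.2.1 h3 ⟨hst, ht₂.le⟩, ?_⟩
        filter_upwards [self_mem_nhdsWithin, nhdsWithin_le_nhds (Iio_mem_nhds ht₂)] with u hu hu'
        exact h1.1.out h1.2.1 h3 ⟨hIint.2.2.1 u hu, le_of_lt hu'⟩
      · push Not at hmax
        obtain ⟨S', h1, h2, h3⟩ := ht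
        refine ⟨S'.1, S'.2, h1, h2, h3, ?_⟩
        filter_upwards [self_mem_nhdsWithin] with u hu
        exact h1.1.out h1.2.1 h3 ⟨hIint.2.2.1 u hu, hmax u hu⟩
    obtain ⟨I', y', h1, h2, h3, h4⟩ := this
    have he := hglue I' y' h1 h2
    rw [(h2.congr hF₀ h3 (he t h3)).2.2.2 j]
    have hmom : ∀ u ∈ I', y.momentum m₀ j u = y'.momentum m₀ j u := fun u hu => by
      rw [Traj.momentum, Traj.momentum, Traj.vel_eqOn (he u hu) j self_mem_Iic]
    exact ((h2.equation t h3 j).congr hmom (hmom t h3)).mono_of_mem_nhdsWithin h4
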